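/- Let $m,r\ge 1$ and $n\ge 0$ be integers, $1\le p\le\infty$, $-\infty<a<b<\infty$ and $\varepsilon_0>0$. For $k\geq 1$ let $W_p^k$ denote the complex Sobolev space of all $y\in C^{k-1}[a,b]$ with $y^{(k-1)}$ absolutely continuous on $[a,b]$ and $y^{(k)}\in L_p[a,b]$, and put $W_p^0=L_p[a,b]$; the norm is $\sum_{j=0}^{k}\|y^{(j)}\|_{p}$. Write $(W_p^k)^m$ and $(W_p^k)^{m\times m}$ for the spaces of vector- and matrix-valued functions with entries in $W_p^k$. For every $\varepsilon\in[0,\varepsilon_0)$ let matrix-valued functions $A_{0}(\cdot;\varepsilon),\dots,A_{r-1}(\cdot;\varepsilon)\in (W_p^n)^{m\times m}$ and a continuous linear operator $B(\varepsilon)\colon (W_p^{n+r})^m\to\mathbb{C}^{rm}$ be given, and consider, for $f(\cdot;\varepsilon)\in(W_p^n)^m$ and $c(\varepsilon)\in\mathbb{C}^{rm}$, the boundary-value problem $$L(\varepsilon)y(t;\varepsilon):=y^{(r)}(t;\varepsilon)+\sum_{j=1}^{r}A_{r-j}(t;\varepsilon)\,y^{(r-j)}(t;\varepsilon)=f(t;\varepsilon),\quad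 t\in(a,b),\qquad B(\varepsilon)y(\cdot;\varepsilon)=c(\varepsilon),$$ for an unknown $y(\cdot;\varepsilon)\in(W_p^{n+r})^m$, where the differential equation is required to hold everywhere on $(a,b)$ if $n\ge1$ and almost everywhere if $n=0$. All limits are taken as $\varepsilon\to0+$. One says that the solution of this problem depends continuously on the parameter $\varepsilon$ at $\varepsilon=0$ if $(*)$ there is a positive number $\varepsilon_1<\varepsilon_0$ such that for every $\varepsilon\in[0,\varepsilon_1)$ and all right-hand sides $f(\cdot;\varepsilon)\in(W_p^n)^m$, $c(\varepsilon)\in\mathbb{C}^{rm}$ the problem has a unique solution $y(\cdot;\varepsilon)\in(W_p^{n+r})^m$; and $(**)$ whenever $f(\cdot;\varepsilon)\to f(\cdot;0)$ in $(W_p^n)^m$ and $c(\varepsilon)\to c(0)$ in $\mathbb{C}^{rm}$, the solutions satisfy $y(\cdot;\varepsilon)\to y(\cdot;0)$ in $(W_p^{n+r})^m$. Theorem. The solution of the problem depends continuously on $\varepsilon$ at $\varepsilon=0$ if and only if the following three conditions hold: (0) the homogeneous limit problem $L(0)y=0$ on $(a,b)$, $B(0)y=0$ has only the trivial solution in $(W_p^{n+r})^m$;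 (I) $A_{r-j}(\cdot;\varepsilon)\to A_{r-j}(\cdot;0)$ in $(W_p^n)^{m\times m}$ for each $j\in\{1,\dots,r\}$; (II) $B(\varepsilon)y\to B(0)y$ in $\mathbb{C}^{rm}$ for every $y\in(W_p^{n+r})^m$. -/

import Mathlib

open Set Filter Topology MeasureTheory
open scoped ENNReal Matrix

namespace BVP

/-- `IsSobolev a b p k u`: the (values on `[a, b]` of the) function `u` belong to
`W_p^k([a, b]; ℂ)`. For `k = 0` this is `L_p`; for `k ≥ 1` it means `u ∈ C^{k-1}[a, b]`,
`u^{(k-1)} ∈ AC[a, b]` and `u^{(k)} ∈ L_p[a, b]`. -/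
def IsSobolev (a b : ℝ) (p : ℝ≥0∞) : ℕ → (ℝ → ℂ) → Prop
  | 0, u => MemLp u p (volume.restrict (Icc a b))
  | k + 1, u =>
      ContDiffOn ℝ k u (Icc a b) ∧
      AbsolutelyContinuousOnInterval (iteratedDerivWithin k u (Icc a b)) a b ∧
      MemLp (iteratedDerivWithin (k + 1) u (Icc a b)) p (volume.restrict (Icc a b))

theorem ae_differentiableWithinAt {a b : ℝ} (hab : a < b) {u : ℝ → ℂ}
    (hu : AbsolutelyContinuousOnInterval u a b) :
    ∀ᵐ t ∂(volume.restrict (Icc a b)), DifferentiableWithinAt ℝ u (Icc a b) t := by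
  have h := hu.boundedVariationOn.locallyBoundedVariationOn
  rw [uIcc_of_le hab.le] at h
  exact h.ae_differentiableWithinAt measurableSet_Icc

theorem IsSobolev.eqOn_add {a b : ℝ} (hab : a < b) {p : ℝ≥0∞} {k : ℕ} {u v : ℝ → ℂ}
    (hu : IsSobolev a b p (k + 1) u) (hv : IsSobolev a b p (k + 1) v) {j : ℕ} (hj : j ≤ k) :
    EqOn (iteratedDerivWithin j (u + v) (Icc a b))
      (iteratedDerivWithin j u (Icc a b) + iteratedDerivWithin j v (Icc a b)) (Icc a b) := by
  intro t ht
  have hjk : ((j : ℕ) : WithTop ℕ∞) ≤ ((k : ℕ) : WithTop ℕ∞) := by exact_mod_cast hj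
  exact iteratedDerivWithin_add ht (uniqueDiffOn_Icc hab)
    ((hu.1.of_le hjk) t ht) ((hv.1.of_le hjk) t ht)

theorem IsSobolev.ae_add {a b : ℝ} (hab : a < b) {p : ℝ≥0∞} {k : ℕ} {u v : ℝ → ℂ}
    (hu : IsSobolev a b p k u) (hv : IsSobolev a b p k v) {j : ℕ} (hj : j ≤ k) :
    iteratedDerivWithin j (u + v) (Icc a b) =ᵐ[volume.restrict (Icc a b)]
      iteratedDerivWithin j u (Icc a b) + iteratedDerivWithin j v (Icc a b) := by
  cases k with
  | zero =>
    obtain rfl : j = 0 := by omega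
    simp only [iteratedDerivWithin_zero]
    exact Filter.EventuallyEq.rfl
  | succ k =>
    rcases Nat.lt_or_ge k j with hkj | hjk
    · obtain rfl : j = k + 1 := by omega
      filter_upwards [ae_differentiableWithinAt hab hu.2.1, ae_differentiableWithinAt hab hv.2.1,
        ae_restrict_mem measurableSet_Icc] with t h1 h2 ht
      have hE := IsSobolev.eqOn_add hab hu hv le_rfl
      rw [iteratedDerivWithin_succ, derivWithin_congr hE (hE ht), derivWithin_add h1 h2,
        Pi.add_apply, iteratedDerivWithin_succ, iteratedDerivWithin_succ]
    · filter_upwards [ae_restrict_mem measurableSet_Icc] with t ht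
      exact IsSobolev.eqOn_add hab hu hv hjk ht

theorem absolutelyContinuous_congr {a b : ℝ} (hab : a < b) {u v : ℝ → ℂ}
    (h : EqOn u v (Icc a b)) (hv : AbsolutelyContinuousOnInterval v a b) :
    AbsolutelyContinuousOnInterval u a b := by
  rw [absolutelyContinuousOnInterval_iff] at hv ⊢
  intro ε hε
  obtain ⟨δ, hδ, H⟩ := hv ε hε
  refine ⟨δ, hδ, fun E hE hlt => ?_⟩
  have := H E hE hlt
  have key : ∀ i ∈ Finset.range E.1, dist (u (E.2 i).1) (u (E.2 i).2)
      = dist (v (E.2 i).1) (v (E.2 i).2) := by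
    intro i hi
    have h1 := hE.1 i hi
    rw [uIcc_of_le hab.le] at h1
    rw [h h1.1, h h1.2]
  rwa [Finset.sum_congr rfl key]

theorem IsSobolev.add {a b : ℝ} (hab : a < b) {p : ℝ≥0∞} {k : ℕ} {u v : ℝ → ℂ}
    (hu : IsSobolev a b p k u) (hv : IsSobolev a b p k v) : IsSobolev a b p k (u + v) := by
  cases k with
  | zero => exact MemLp.add hu hv
  | succ k =>
    exact ⟨hu.1.add hv.1,
      absolutelyContinuous_congr hab (IsSobolev.eqOn_add hab hu hv le_rfl) (hu.2.1.add hv.2.1),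
      (memLp_congr_ae (IsSobolev.ae_add hab hu hv le_rfl)).2 (hu.2.2.add hv.2.2)⟩

theorem iteratedDerivWithin_smul (a b : ℝ) (z : ℂ) (u : ℝ → ℂ) (j : ℕ) :
    iteratedDerivWithin j (z • u) (Icc a b) = z • iteratedDerivWithin j u (Icc a b) := by
  funext t
  exact iteratedDerivWithin_const_smul_field z u

theorem IsSobolev.smul {a b : ℝ} {p : ℝ≥0∞} {k : ℕ} {u : ℝ → ℂ} (z : ℂ)
    (hu : IsSobolev a b p k u) : IsSobolev a b p k (z • u) := by
  cases k with
  | zero => exact MemLp.const_smul hu z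
  | succ k =>
    refine ⟨hu.1.const_smul z, ?_, ?_⟩
    · rw [iteratedDerivWithin_smul]
      exact hu.2.1.const_smul z
    · rw [iteratedDerivWithin_smul]
      exact hu.2.2.const_smul z

theorem IsSobolev.zero (a b : ℝ) (p : ℝ≥0∞) (k : ℕ) : IsSobolev a b p k 0 := by
  have h0 : ∀ j, iteratedDerivWithin j (0 : ℝ → ℂ) (Icc a b) = 0 := fun j => by
    have := iteratedDerivWithin_smul a b 0 0 j
    simpa using this
  cases k with
  | zero => exact MemLp.zero
  | succ k =>
    refine ⟨contDiffOn_const, ?_, ?_⟩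
    · rw [h0, absolutelyContinuousOnInterval_iff]
      exact fun ε hε => ⟨1, one_pos, fun E _ _ => by simpa using hε⟩
    · rw [h0]
      exact MemLp.zero

/-- The Sobolev space `W_p^k([a, b]; ℂ)`: a function `u` with `IsSobolev a b p k u`, up to
equality almost everywhere on `[a, b]`, is recorded as the tuple
`(u, u', …, u^{(k)}) ∈ (L_p[a, b])^{k+1}`. The norm inherited from the `ℓ¹`-product is
`∑_{j ≤ k} ‖u^{(j)}‖_p` (see `sobolev_norm_eq`). -/
noncomputable def sobolev {a b : ℝ} (hab : a < b) (p : ℝ≥0∞) [Fact (1 ≤ p)] (k : ℕ) :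
    Submodule ℂ (PiLp 1 (fun _ : Fin (k + 1) => Lp ℂ p (volume.restrict (Icc a b)))) where
  carrier := {Y | ∃ u : ℝ → ℂ, IsSobolev a b p k u ∧
    ∀ j : Fin (k + 1), Y j =ᵐ[volume.restrict (Icc a b)] iteratedDerivWithin j u (Icc a b)}
  add_mem' := by
    rintro Y Z ⟨u, hu, hY⟩ ⟨v, hv, hZ⟩
    refine ⟨u + v, IsSobolev.add hab hu hv, fun j => ?_⟩
    have h1 := IsSobolev.ae_add hab hu hv (Nat.lt_succ_iff.1 j.2)
    exact ((Lp.coeFn_add (Y j) (Z j)).trans ((hY j).add (hZ j))).trans h1.symm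
  zero_mem' := by
    refine ⟨0, IsSobolev.zero a b p k, fun j => ?_⟩
    have := iteratedDerivWithin_smul a b 0 0 (j : ℕ)
    rw [zero_smul, zero_smul] at this
    rw [this]
    exact Lp.coeFn_zero _ _ _
  smul_mem' := by
    rintro z Y ⟨u, hu, hY⟩
    refine ⟨z • u, IsSobolev.smul z hu, fun j => ?_⟩
    rw [iteratedDerivWithin_smul]
    exact (Lp.coeFn_smul z (Y j)).trans ((hY j).const_smul z)

section

variable {a b : ℝ} {hab : a < b} {p : ℝ≥0∞} [Fact (1 ≤ p)] {k : ℕ}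

/-- A function on `[a, b]` representing an element of `W_p^k`. For `k ≥ 1` its values on `[a, b]`
are uniquely determined (it is the continuous representative); for `k = 0` they are determined
almost everywhere. -/
noncomputable def rep (y : sobolev hab p k) : ℝ → ℂ := Classical.choose y.2

/-- The value `y^{(j)}(t)` of the derivative of order `j` of `y ∈ W_p^k`, for `j ≤ k`. -/
noncomputable def der (j : ℕ) (y : sobolev hab p k) (t : ℝ) : ℂ :=
  iteratedDerivWithin j (rep y) (Icc a b) t

theorem isSobolev_rep (y : sobolev hab p k) : IsSobolev a b p k (rep y) :=
  (Classical.choose_spec y.2).1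

theorem coe_ae_eq_der (y : sobolev hab p k) (j : Fin (k + 1)) :
    y.1 j =ᵐ[volume.restrict (Icc a b)] der j y :=
  (Classical.choose_spec y.2).2 j

theorem sobolev_norm_eq (y : sobolev hab p k) :
    ‖y‖ = ∑ j ∈ Finset.range (k + 1), (eLpNorm (der j y) p (volume.restrict (Icc a b))).toReal := by
  rw [Submodule.coe_norm, PiLp.norm_eq_of_L1, Finset.sum_range]
  refine Finset.sum_congr rfl fun j _ => ?_
  rw [Lp.norm_def, eLpNorm_congr_ae (coe_ae_eq_der y j)]

end

section

variable {a b : ℝ} {hab : a < b} {p : ℝ≥0∞} [Fact (1 ≤ p)] {m n r : ℕ}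

/-- `(L y)(t) = y^{(r)}(t) + ∑_{j < r} A_j(t) y^{(j)}(t)` for `A_0, …, A_{r-1} ∈ (W_p^n)^{m × m}`
and `y ∈ (W_p^{n+r})^m`. -/
noncomputable def diffExpr (A : Fin r → Matrix (Fin m) (Fin m) (sobolev hab p n))
    (y : Fin m → sobolev hab p (n + r)) (t : ℝ) : Fin m → ℂ :=
  (fun i => der r (y i) t) +
    ∑ j : Fin r, (A j).map (fun x => der 0 x t) *ᵥ (fun i => der j (y i) t)

/-- `y ∈ (W_p^{n+r})^m` solves `L y = f` on `(a, b)`, `B y = c`. The differential equation holds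
almost everywhere if `n = 0` and everywhere if `n ≥ 1`. -/
def IsSolution (A : Fin r → Matrix (Fin m) (Fin m) (sobolev hab p n))
    (B : (Fin m → sobolev hab p (n + r)) →L[ℂ] (Fin (r * m) → ℂ))
    (f : Fin m → sobolev hab p n) (c : Fin (r * m) → ℂ)
    (y : Fin m → sobolev hab p (n + r)) : Prop :=
  (if n = 0 then ∀ᵐ t ∂(volume.restrict (Ioo a b)), diffExpr A y t = fun i => der 0 (f i) t
    else ∀ t ∈ Ioo a b, diffExpr A y t = fun i => der 0 (f i) t) ∧
  B y = c

/-- The solution of the boundary-value problem with coefficients `A ε` and boundary operator `B ε`,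
`0 ≤ ε < ε₀`, depends continuously on `ε` at `ε = 0`: for all small `ε` the problem is uniquely
solvable for arbitrary right-hand sides, and convergence of right-hand sides as `ε → 0+` implies
convergence of the solutions. -/
def DependsContinuously (ε₀ : ℝ) (A : ℝ → Fin r → Matrix (Fin m) (Fin m) (sobolev hab p n))
    (B : ℝ → (Fin m → sobolev hab p (n + r)) →L[ℂ] (Fin (r * m) → ℂ)) : Prop :=
  ∃ ε₁ : ℝ, 0 < ε₁ ∧ ε₁ < ε₀ ∧
    (∀ ε ∈ Ico 0 ε₁, ∀ (f : Fin m → sobolev hab p n) (c : Fin (r * m) → ℂ),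
      ∃! y : Fin m → sobolev hab p (n + r), IsSolution (A ε) (B ε) f c y) ∧
    (∀ (f : ℝ → Fin m → sobolev hab p n) (c : ℝ → Fin (r * m) → ℂ)
      (y : ℝ → Fin m → sobolev hab p (n + r)),
      (∀ ε ∈ Ico 0 ε₁, IsSolution (A ε) (B ε) (f ε) (c ε) (y ε)) →
      Tendsto f (𝓝[>] 0) (𝓝 (f 0)) → Tendsto c (𝓝[>] 0) (𝓝 (c 0)) →
      Tendsto y (𝓝[>] 0) (𝓝 (y 0)))

end

end BVP

namespace BVP

/-! Write `L(ε) = d + P A(ε)`, where `d y = y^(r)` and `P` is a bounded bilinear action of the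
coefficients. This uses that `W_p^k` is a Banach space and that multiplication `W_p^n × W_p^{n+1} →
W_p^n` is bounded. Continuous dependence then means that `(L(ε), B(ε))` is bijective at `ε = 0` and
for small `ε > 0`, and that convergence of the data forces convergence of the solutions
(`solutionContinuous_iff`).

Sufficiency. The Cauchy problem is solvable for all data (`exists_cauchy_solution`). Comparing
`B(0)` with the Cauchy data on `ker L(0)`, both with values in dimension `rm`, turns condition (0)
into bijectivity of `(L(0), B(0))`. Condition (I) gives norm convergence of `L(ε)`, but (II) gives
only strong convergence of `B(ε)`, so openness of the set of invertible operators does not apply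
directly. After composition with the inverse `S` of the limit operator, the only block that need not
be small in norm is an off-diagonal one, `γ`. It has square zero, so `1 + γ` is invertible and `(L,
B) S = (1 + γ) U`. By Banach–Steinhaus `γ` stays bounded, whence `U → 1` in norm
(`eventually_bijective_and_tendsto`).

Necessity of (I). Take as limit solutions the functions `t^l / l!` placed in one component, and
solve the perturbed problems with the same data. The values of `P A` at these test functions
determine `A` through a triangular system (`exists_norm_le_sum`). Subtracting equations gives `‖A(ε)
- A(0)‖ ≤ o(1) ‖A(ε) - A(0)‖ + o(1)`, and the first term is absorbed, with no a priori bound on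
`A(ε)` (`tendsto_coefficient`).

Necessity of (II). For fixed `y` let `x(ε)` solve `L(ε) x = L(ε) y`, `B(ε) x = 0`. Then `y - x(ε)`
is the combination, with coefficients `B(ε) y`, of the homogeneous solutions whose boundary values
are the basis vectors. Applying `B(0)` gives `Θ(ε) B(ε) y = B(0)(y - x(ε))` with `Θ(ε) → 1`, and the
right-hand side tends to `B(0) y` (`tendsto_apply_of_continuity`). -/

/-! ### Absolutely continuous functions and primitives. -/

theorem absolutelyContinuousOnInterval_of_dist_le {a b : ℝ} {f : ℝ → ℂ} {g : ℝ → ℝ}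
    (hg : AbsolutelyContinuousOnInterval g a b)
    (h : ∀ x ∈ uIcc a b, ∀ y ∈ uIcc a b, dist (f x) (f y) ≤ dist (g x) (g y)) :
    AbsolutelyContinuousOnInterval f a b := by
  rw [absolutelyContinuousOnInterval_iff] at hg ⊢
  intro ε hε
  obtain ⟨δ, hδ, H⟩ := hg ε hε
  refine ⟨δ, hδ, fun E hE hlt => lt_of_le_of_lt (Finset.sum_le_sum fun i hi => ?_) (H E hE hlt)⟩
  exact h _ (hE.1 i hi).1 _ (hE.1 i hi).2

/-- The increments are dominated by those of the real primitive of `‖f‖`. -/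
theorem absolutelyContinuousOnInterval_integral {a b : ℝ} {f : ℝ → ℂ}
    (hf : IntervalIntegrable f volume a b) :
    AbsolutelyContinuousOnInterval (fun x => ∫ s in a..x, f s) a b := by
  refine absolutelyContinuousOnInterval_of_dist_le
    (hf.norm.absolutelyContinuousOnInterval_intervalIntegral (c := a) left_mem_uIcc) ?_
  intro x hx y hy
  have h1 : IntervalIntegrable f volume a x := hf.mono_set (uIcc_subset_uIcc_left hx)
  have h2 : IntervalIntegrable f volume a y := hf.mono_set (uIcc_subset_uIcc_left hy)
  rw [dist_eq_norm, dist_eq_norm, intervalIntegral.integral_interval_sub_left h1 h2,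
    intervalIntegral.integral_interval_sub_left h1.norm h2.norm]
  exact intervalIntegral.norm_integral_le_abs_integral_norm

theorem intervalIntegrable_of_integrable {a b : ℝ} (hab : a < b) {E : Type*}
    [NormedAddCommGroup E] {f : ℝ → E}
    (hf : Integrable f (volume.restrict (Icc a b))) : IntervalIntegrable f volume a b :=
  (intervalIntegrable_iff_integrableOn_Icc_of_le hab.le).2 hf

theorem ae_hasDerivWithinAt_integral {a b : ℝ} (hab : a < b) {f : ℝ → ℂ}
    (hf : Integrable f (volume.restrict (Icc a b))) :
    ∀ᵐ t ∂(volume.restrict (Icc a b)),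
      HasDerivAt (fun x => ∫ s in a..x, f s) (f t) t := by
  have h := (intervalIntegrable_of_integrable hab hf).ae_hasDerivAt_integral
  rw [uIcc_of_le hab.le] at h
  rw [ae_restrict_iff' measurableSet_Icc]
  filter_upwards [h] with t ht hmem
  exact ht hmem a (left_mem_Icc.2 hab.le)

theorem ae_mem_Ioo {a b : ℝ} : ∀ᵐ t ∂(volume.restrict (Icc a b)), t ∈ Ioo a b := by
  rw [← restrict_Ioo_eq_restrict_Icc]
  exact ae_restrict_mem measurableSet_Ioo

/-- The difference between `u` and the primitive of its derivative is absolutely continuous with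
derivative zero a.e., hence constant. -/
theorem eq_add_integral_derivWithin {a b : ℝ} (hab : a < b) {u : ℝ → ℂ}
    (hu : AbsolutelyContinuousOnInterval u a b)
    (hint : Integrable (derivWithin u (Icc a b)) (volume.restrict (Icc a b))) {t : ℝ}
    (ht : t ∈ Icc a b) : u t = u a + ∫ s in a..t, derivWithin u (Icc a b) s := by
  have hI := absolutelyContinuousOnInterval_integral (intervalIntegrable_of_integrable hab hint)
  have hz : ∀ᵐ x, x ∈ uIcc a b →
      HasDerivAt (u - fun x => ∫ s in a..x, derivWithin u (Icc a b) s) 0 x := by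
    rw [uIcc_of_le hab.le, ← ae_restrict_iff' measurableSet_Icc]
    filter_upwards [ae_differentiableWithinAt hab hu, ae_hasDerivWithinAt_integral hab hint,
      ae_mem_Ioo] with x h1 h2 h3
    have h4 := h1.hasDerivWithinAt.hasDerivAt (Icc_mem_nhds h3.1 h3.2)
    simpa using h4.sub h2
  obtain ⟨C, hC⟩ := (hu.sub hI).const_of_ae_hasDerivAt_zero hz
  rw [uIcc_of_le hab.le] at hC
  have h1 := hC t ht
  have h2 := hC a (left_mem_Icc.2 hab.le)
  simp only [Pi.sub_apply, intervalIntegral.integral_same, sub_zero] at h1 h2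
  rw [h2, ← h1]; ring

/-! ### Calculus of the predicate `IsSobolev`. -/

section

variable {a b : ℝ} {p : ℝ≥0∞} {k : ℕ} {u v : ℝ → ℂ}

theorem isSobolev_one (hab : a < b) : IsSobolev a b p 1 u ↔
    AbsolutelyContinuousOnInterval u a b ∧
      MemLp (derivWithin u (Icc a b)) p (volume.restrict (Icc a b)) := by
  simp only [IsSobolev, iteratedDerivWithin_zero, zero_add, iteratedDerivWithin_one,
    Nat.cast_zero]
  refine ⟨fun h => ⟨h.2.1, ?_⟩, fun h => ⟨?_, h.1, ?_⟩⟩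
  · convert h.2.2 using 1
  · have := h.1.continuousOn
    rw [uIcc_of_le hab.le] at this
    exact contDiffOn_zero.2 this
  · convert h.2 using 1

/-- The recursion starts at order 2: a function of order 1 is differentiable only almost everywhere,
and `isSobolev_one` serves as the base case. -/
theorem isSobolev_succ_succ (hab : a < b) : IsSobolev a b p (k + 2) u ↔
    DifferentiableOn ℝ u (Icc a b) ∧ IsSobolev a b p (k + 1) (derivWithin u (Icc a b)) := by
  have e : ∀ j, iteratedDerivWithin (j + 1) u (Icc a b)
      = iteratedDerivWithin j (derivWithin u (Icc a b)) (Icc a b) := fun j => by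
    funext t; rw [iteratedDerivWithin_succ']
  have h := contDiffOn_succ_iff_derivWithin (𝕜 := ℝ) (f := u) (n := (k : ℕ))
    (uniqueDiffOn_Icc hab)
  simp only [IsSobolev, e]
  have : ((k + 1 : ℕ) : WithTop ℕ∞) = (k : WithTop ℕ∞) + 1 := by push_cast; rfl
  rw [this, h]
  simp only [WithTop.natCast_ne_top, and_assoc]
  simp

theorem IsSobolev.derivWithin (hab : a < b) (hu : IsSobolev a b p (k + 1) u) :
    IsSobolev a b p k (derivWithin u (Icc a b)) := by
  cases k with
  | zero => exact ((isSobolev_one hab).1 hu).2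
  | succ k => exact ((isSobolev_succ_succ hab).1 hu).2

theorem IsSobolev.continuousOn (hu : IsSobolev a b p (k + 1) u) : ContinuousOn u (Icc a b) :=
  hu.1.continuousOn

theorem memLp_of_continuousOn (hu : ContinuousOn u (Icc a b)) :
    MemLp u p (volume.restrict (Icc a b)) := by
  obtain ⟨C, hC⟩ := isCompact_Icc.exists_bound_of_continuousOn hu
  exact MemLp.of_bound (hu.aestronglyMeasurable measurableSet_Icc) C
    ((ae_restrict_iff' measurableSet_Icc).2 (Eventually.of_forall hC))

theorem IsSobolev.of_succ (hab : a < b) (hu : IsSobolev a b p (k + 1) u) :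
    IsSobolev a b p k u := by
  induction k generalizing u with
  | zero => exact memLp_of_continuousOn hu.continuousOn
  | succ k ih =>
    cases k with
    | zero =>
      refine (isSobolev_one hab).2 ⟨?_, memLp_of_continuousOn (hu.derivWithin hab).continuousOn⟩
      refine ContDiffOn.absolutelyContinuousOnInterval ?_
      rw [uIcc_of_le hab.le]
      exact hu.1
    | succ k =>
      have h := (isSobolev_succ_succ hab).1 hu
      exact (isSobolev_succ_succ hab).2 ⟨h.1, ih h.2⟩

theorem IsSobolev.iteratedDerivWithin (hab : a < b) {j l : ℕ} (hu : IsSobolev a b p k u)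
    (h : j + l ≤ k) : IsSobolev a b p l (iteratedDerivWithin j u (Icc a b)) := by
  induction j generalizing k u with
  | zero =>
    rw [iteratedDerivWithin_zero]
    rw [zero_add] at h
    induction k with
    | zero => obtain rfl : l = 0 := by omega
              exact hu
    | succ k ih =>
      rcases Nat.lt_or_ge k l with h1 | h1
      · obtain rfl : l = k + 1 := by omega
        exact hu
      · exact ih (hu.of_succ hab) h1
  | succ j ih =>
    obtain ⟨k, rfl⟩ : ∃ k', k = k' + 1 := ⟨k - 1, by omega⟩
    have e : _root_.iteratedDerivWithin (j + 1) u (Icc a b) = _root_.iteratedDerivWithin j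
      (_root_.derivWithin u (Icc a b)) (Icc a b) := by
      funext t; rw [iteratedDerivWithin_succ']
    rw [e]
    exact ih (hu.derivWithin hab) (by omega)

theorem IsSobolev.mono (hab : a < b) {l : ℕ} (hu : IsSobolev a b p k u) (h : l ≤ k) :
    IsSobolev a b p l u := by
  have := hu.iteratedDerivWithin hab (j := 0) (l := l) (by omega)
  rwa [iteratedDerivWithin_zero] at this

theorem IsSobolev.memLp (hab : a < b) (hu : IsSobolev a b p k u) :
    MemLp u p (volume.restrict (Icc a b)) := hu.mono hab (Nat.zero_le k)

theorem IsSobolev.congr (hab : a < b) (hu : IsSobolev a b p k u) (h : EqOn v u (Icc a b)) :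
    IsSobolev a b p k v := by
  have e : ∀ j, EqOn (_root_.iteratedDerivWithin j v (Icc a b))
      (_root_.iteratedDerivWithin j u (Icc a b)) (Icc a b) :=
    fun j t ht => iteratedDerivWithin_congr h ht
  have e' : ∀ j, _root_.iteratedDerivWithin j v (Icc a b) =ᵐ[volume.restrict (Icc a b)]
      _root_.iteratedDerivWithin j u (Icc a b) := fun j =>
    (ae_restrict_iff' measurableSet_Icc).2 (Eventually.of_forall (e j))
  cases k with
  | zero =>
    refine (memLp_congr_ae ?_).2 hu
    simpa using e' 0
  | succ k =>
    exact ⟨hu.1.congr h, absolutelyContinuous_congr hab (e k) hu.2.1,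
      (memLp_congr_ae (e' _)).2 hu.2.2⟩

theorem eqOn_Icc_of_ae_eq (hab : a < b) (hu : ContinuousOn u (Icc a b))
    (hv : ContinuousOn v (Icc a b)) (h : u =ᵐ[volume.restrict (Icc a b)] v) :
    EqOn u v (Icc a b) :=
  Measure.eqOn_Icc_of_ae_eq volume hab.ne h hu hv

/-- For `k ≥ 1` both functions are continuous, so a.e. equality is equality on the interval. This
makes the choice of representative in `rep` harmless for derivatives. -/
theorem IsSobolev.ae_eq_iteratedDerivWithin (hab : a < b) (hu : IsSobolev a b p k u)
    (hv : IsSobolev a b p k v) (h : u =ᵐ[volume.restrict (Icc a b)] v) {j : ℕ} (hj : j ≤ k) :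
    _root_.iteratedDerivWithin j u (Icc a b) =ᵐ[volume.restrict (Icc a b)]
      _root_.iteratedDerivWithin j v (Icc a b) := by
  cases k with
  | zero =>
    obtain rfl : j = 0 := by omega
    simpa using h
  | succ k =>
    exact (ae_restrict_iff' measurableSet_Icc).2 (Eventually.of_forall fun t ht =>
      iteratedDerivWithin_congr (eqOn_Icc_of_ae_eq hab hu.continuousOn hv.continuousOn h) ht)

theorem IsSobolev.integrable (hab : a < b) (hp : 1 ≤ p) (hu : IsSobolev a b p k u) :
    Integrable u (volume.restrict (Icc a b)) := (hu.memLp hab).integrable hp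

theorem hasDerivWithinAt_integral (c : ℂ) (hu : ContinuousOn u (Icc a b)) {t : ℝ}
    (ht : t ∈ Icc a b) :
    HasDerivWithinAt (fun x => c + ∫ s in a..x, u s) (u t) (Icc a b) t := by
  have hint : IntervalIntegrable u volume a t :=
    (hu.mono (by rw [uIcc_of_le ht.1]; exact Icc_subset_Icc_right ht.2)).intervalIntegrable
  have : Fact (t ∈ Icc a b) := ⟨ht⟩
  refine HasDerivWithinAt.const_add c ?_
  exact intervalIntegral.integral_hasDerivWithinAt_right hint
    (hu.stronglyMeasurableAtFilter_nhdsWithin measurableSet_Icc t) (hu t ht)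

theorem ae_derivWithin_integral (hab : a < b) (c : ℂ)
    (hu : Integrable u (volume.restrict (Icc a b))) :
    _root_.derivWithin (fun x => c + ∫ s in a..x, u s) (Icc a b)
      =ᵐ[volume.restrict (Icc a b)] u := by
  filter_upwards [ae_hasDerivWithinAt_integral hab hu, ae_restrict_mem measurableSet_Icc]
    with t ht hmem
  exact ((ht.const_add c).hasDerivWithinAt).derivWithin (uniqueDiffOn_Icc hab t hmem)

theorem IsSobolev.const_add_integral (hab : a < b) (hp : 1 ≤ p) (c : ℂ)
    (hu : IsSobolev a b p k u) : IsSobolev a b p (k + 1) (fun t => c + ∫ s in a..t, u s) := by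
  cases k with
  | zero =>
    have hi := hu.integrable hab hp
    refine (isSobolev_one hab).2 ⟨?_, (memLp_congr_ae (ae_derivWithin_integral hab c hi)).2 hu⟩
    have h := absolutelyContinuousOnInterval_integral (intervalIntegrable_of_integrable hab hi)
    have hc : AbsolutelyContinuousOnInterval (fun _ : ℝ => c) a b :=
      (contDiff_const (n := 1)).contDiffOn.absolutelyContinuousOnInterval
    exact hc.add h
  | succ k =>
    have hd : ∀ t ∈ Icc a b, HasDerivWithinAt (fun x => c + ∫ s in a..x, u s) (u t) (Icc a b) t :=
      fun t ht => hasDerivWithinAt_integral c hu.continuousOn ht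
    refine (isSobolev_succ_succ hab).2 ⟨fun t ht => (hd t ht).differentiableWithinAt, ?_⟩
    exact hu.congr hab fun t ht => (hd t ht).derivWithin (uniqueDiffOn_Icc hab t ht)

theorem IsSobolev.eq_add_integral (hab : a < b) (hp : 1 ≤ p) (hu : IsSobolev a b p (k + 1) u)
    {t : ℝ} (ht : t ∈ Icc a b) :
    u t = u a + ∫ s in a..t, _root_.derivWithin u (Icc a b) s := by
  have h := (isSobolev_one hab).1 (hu.mono hab (Nat.succ_le_succ (Nat.zero_le k)))
  exact eq_add_integral_derivWithin hab h.1 (h.2.integrable hp) ht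

theorem ae_derivWithin_mul (hab : a < b) (hu : IsSobolev a b p (k + 1) u)
    (hv : IsSobolev a b p (k + 1) v) :
    _root_.derivWithin (u * v) (Icc a b) =ᵐ[volume.restrict (Icc a b)]
      _root_.derivWithin u (Icc a b) * v + u * _root_.derivWithin v (Icc a b) := by
  have h1 := (isSobolev_one hab).1 (hu.mono hab (Nat.succ_le_succ (Nat.zero_le k)))
  have h2 := (isSobolev_one hab).1 (hv.mono hab (Nat.succ_le_succ (Nat.zero_le k)))
  filter_upwards [ae_differentiableWithinAt hab h1.1, ae_differentiableWithinAt hab h2.1,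
    ae_restrict_mem measurableSet_Icc] with t hu hv ht
  rw [derivWithin_mul hu hv]; rfl

theorem memLp_mul_continuousOn (hu : MemLp u p (volume.restrict (Icc a b)))
    (hv : ContinuousOn v (Icc a b)) : MemLp (u * v) p (volume.restrict (Icc a b)) :=
  (memLp_of_continuousOn (p := ∞) hv).mul hu

/-- From order 1 on the factors are continuous, hence bounded, so the Leibniz rule stays in `L_p`;
at order 0 the product may leave the space. -/
theorem IsSobolev.mul (hab : a < b) (hu : IsSobolev a b p (k + 1) u)
    (hv : IsSobolev a b p (k + 1) v) : IsSobolev a b p (k + 1) (u * v) := by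
  induction k generalizing u v with
  | zero =>
    have h1 := (isSobolev_one hab).1 hu
    have h2 := (isSobolev_one hab).1 hv
    refine (isSobolev_one hab).2
      ⟨h1.1.smul h2.1, (memLp_congr_ae (ae_derivWithin_mul hab hu hv)).2 ?_⟩
    refine MemLp.add (memLp_mul_continuousOn h1.2 hv.continuousOn) ?_
    rw [mul_comm]
    exact memLp_mul_continuousOn h2.2 hu.continuousOn
  | succ k ih =>
    have h1 := (isSobolev_succ_succ hab).1 hu
    have h2 := (isSobolev_succ_succ hab).1 hv
    refine (isSobolev_succ_succ hab).2 ⟨h1.1.mul h2.1, ?_⟩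
    refine ((ih h1.2 (hv.of_succ hab)).add hab (ih (hu.of_succ hab) h2.2)).congr hab ?_
    intro t ht
    rw [derivWithin_mul (h1.1 t ht) (h2.1 t ht)]; rfl

theorem IsSobolev.mul_succ (hab : a < b) (hu : IsSobolev a b p k u)
    (hv : IsSobolev a b p (k + 1) v) : IsSobolev a b p k (u * v) := by
  cases k with
  | zero => exact memLp_mul_continuousOn hu hv.continuousOn
  | succ k => exact hu.mul hab (hv.of_succ hab)

theorem isSobolev_of_contDiff (hab : a < b) (hu : ContDiff ℝ ((⊤ : ℕ∞) : WithTop ℕ∞) u) :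
    IsSobolev a b p k u := by
  have hd : ∀ {u : ℝ → ℂ}, ContDiff ℝ ((⊤ : ℕ∞) : WithTop ℕ∞) u →
      EqOn (_root_.derivWithin u (Icc a b)) (deriv u) (Icc a b) := fun hu t ht =>
    ((contDiff_infty_iff_deriv.1 hu).1 t).derivWithin (uniqueDiffOn_Icc hab t ht)
  induction k generalizing u with
  | zero => exact memLp_of_continuousOn hu.continuous.continuousOn
  | succ k ih =>
    have h := contDiff_infty_iff_deriv.1 hu
    cases k with
    | zero =>
      refine (isSobolev_one hab).2 ⟨(hu.of_le ?_).contDiffOn.absolutelyContinuousOnInterval, ?_⟩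
      · exact_mod_cast (le_top : ((1 : ℕ) : ℕ∞) ≤ ⊤)
      · exact memLp_of_continuousOn (h.2.continuous.continuousOn.congr (hd hu))
    | succ k =>
      exact (isSobolev_succ_succ hab).2
        ⟨h.1.differentiableOn, (ih h.2).congr hab (hd hu)⟩

end

/-! ### Norm estimates on a compact interval. -/

section

variable {a b : ℝ} {p : ℝ≥0∞} {k : ℕ}

theorem iteratedDerivWithin_iteratedDerivWithin (i j : ℕ) (u : ℝ → ℂ) (s : Set ℝ) :
    iteratedDerivWithin i (iteratedDerivWithin j u s) s = iteratedDerivWithin (i + j) u s := by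
  induction j generalizing u with
  | zero => simp
  | succ j ih =>
    have e : iteratedDerivWithin (j + 1) u s = iteratedDerivWithin j (derivWithin u s) s := by
      funext t; rw [iteratedDerivWithin_succ']
    rw [e, ih, ← add_assoc]
    funext t; rw [iteratedDerivWithin_succ']

theorem IsSobolev.memLp_iteratedDerivWithin (hab : a < b) {u : ℝ → ℂ} (hu : IsSobolev a b p k u)
    (j : Fin (k + 1)) :
    MemLp (_root_.iteratedDerivWithin j u (Icc a b)) p (volume.restrict (Icc a b)) :=
  hu.iteratedDerivWithin hab (j := j) (l := 0) (by omega)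

theorem exists_integral_norm_le (a b : ℝ) (p : ℝ≥0∞) (hp : 1 ≤ p) : ∃ C : ℝ, 0 ≤ C ∧
    ∀ u : ℝ → ℂ, MemLp u p (volume.restrict (Icc a b)) →
      ∫ t in Icc a b, ‖u t‖ ≤ C * (eLpNorm u p (volume.restrict (Icc a b))).toReal := by
  refine ⟨(volume.restrict (Icc a b) univ ^ (1 / (1 : ℝ≥0∞).toReal - 1 / p.toReal)).toReal,
    ENNReal.toReal_nonneg, fun u hu => ?_⟩
  have h := eLpNorm_le_eLpNorm_mul_rpow_measure_univ hp hu.1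
  have hfin : (volume.restrict (Icc a b) univ ^ (1 / (1 : ℝ≥0∞).toReal - 1 / p.toReal)) ≠ ∞ := by
    refine ENNReal.rpow_ne_top_of_nonneg ?_ (by simp)
    rw [sub_nonneg, one_div, one_div, ENNReal.toReal_one, inv_one]
    -- At `p = ∞` the value of `p.toReal` is 0, so `1 / p.toReal` is 0, which is the correct
    -- exponent.
    rcases eq_or_ne p ∞ with rfl | hpt
    · simp
    · exact inv_le_one_of_one_le₀ (by simpa using ENNReal.toReal_mono hpt hp)
  rw [mul_comm, ← ENNReal.toReal_mul, integral_norm_eq_lintegral_enorm hu.1,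
    ← eLpNorm_one_eq_lintegral_enorm]
  exact ENNReal.toReal_mono (ENNReal.mul_ne_top hu.2.ne hfin) h

theorem exists_eLpNorm_le_of_bound (a b : ℝ) (p : ℝ≥0∞) : ∃ C : ℝ, 0 ≤ C ∧
    ∀ (u : ℝ → ℂ) (M : ℝ), 0 ≤ M → (∀ t ∈ Icc a b, ‖u t‖ ≤ M) →
      (eLpNorm u p (volume.restrict (Icc a b))).toReal ≤ C * M := by
  refine ⟨(volume.restrict (Icc a b) univ ^ p.toReal⁻¹).toReal, ENNReal.toReal_nonneg,
    fun u M hM hu => ?_⟩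
  have h := eLpNorm_le_of_ae_bound (p := p) (f := u) (C := M) (μ := volume.restrict (Icc a b))
    ((ae_restrict_iff' measurableSet_Icc).2 (Eventually.of_forall hu))
  have hfin : volume.restrict (Icc a b) univ ^ p.toReal⁻¹ ≠ ∞ :=
    ENNReal.rpow_ne_top_of_nonneg (by simp) (by simp)
  rw [← ENNReal.toReal_ofReal hM, ← ENNReal.toReal_mul]
  exact ENNReal.toReal_mono (ENNReal.mul_ne_top hfin ENNReal.ofReal_ne_top) h

theorem eLpNorm_mul_le_of_bound {u v : ℝ → ℂ} {M : ℝ} (hM : 0 ≤ M)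
    (hu : MemLp u p (volume.restrict (Icc a b))) (hv : ∀ t ∈ Icc a b, ‖v t‖ ≤ M) :
    (eLpNorm (u * v) p (volume.restrict (Icc a b))).toReal
      ≤ M * (eLpNorm u p (volume.restrict (Icc a b))).toReal := by
  have h := eLpNorm_le_mul_eLpNorm_of_ae_le_mul (f := u * v) (g := u) (c := M)
    (μ := volume.restrict (Icc a b))
    ((ae_restrict_iff' measurableSet_Icc).2 (Eventually.of_forall fun t ht => by
      rw [Pi.mul_apply, norm_mul, mul_comm]
      exact mul_le_mul_of_nonneg_right (hv t ht) (norm_nonneg _))) p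
  rw [← ENNReal.toReal_ofReal hM, ← ENNReal.toReal_mul]
  exact ENNReal.toReal_mono (ENNReal.mul_ne_top ENNReal.ofReal_ne_top hu.2.ne) h

theorem norm_integral_le_integral_norm_Icc {u : ℝ → ℂ}
    (hu : Integrable u (volume.restrict (Icc a b))) {t : ℝ} (ht : t ∈ Icc a b) :
    ‖∫ s in a..t, u s‖ ≤ ∫ s in Icc a b, ‖u s‖ := by
  refine (intervalIntegral.norm_integral_le_integral_norm ht.1).trans ?_
  rw [intervalIntegral.integral_of_le ht.1]
  exact setIntegral_mono_set hu.norm (Eventually.of_forall fun _ => norm_nonneg _)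
    (Eventually.of_forall fun s hs => ⟨hs.1.le, hs.2.trans ht.2⟩)

end

/-! ### The Banach space `W_p^k`: derivatives, endpoint values, primitives, completeness. -/

section

variable {a b : ℝ} {hab : a < b} {p : ℝ≥0∞} [hp : Fact (1 ≤ p)] {k : ℕ}

/-- The element of `W_p^k` given by a function. -/
noncomputable def sobolevMk (hab : a < b) {u : ℝ → ℂ} (hu : IsSobolev a b p k u) :
    sobolev hab p k :=
  ⟨WithLp.toLp 1 fun j : Fin (k + 1) =>
    MemLp.toLp (iteratedDerivWithin j u (Icc a b)) (hu.memLp_iteratedDerivWithin hab j),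
    u, hu, fun j => MemLp.coeFn_toLp (hu.memLp_iteratedDerivWithin hab j)⟩

theorem der_one (x : sobolev hab p k) : der 1 x = derivWithin (rep x) (Icc a b) := by
  funext t; rw [der, iteratedDerivWithin_one]

theorem der_zero (x : sobolev hab p k) : der 0 x = rep x := by
  funext t; rw [der, iteratedDerivWithin_zero]

theorem coe_zero_ae_eq_rep (x : sobolev hab p k) :
    x.1 0 =ᵐ[volume.restrict (Icc a b)] rep x := by
  have h := coe_ae_eq_der x 0
  rwa [Fin.val_zero, der_zero] at h

theorem der_ae_eq {u : ℝ → ℂ} (hu : IsSobolev a b p k u) {x : sobolev hab p k}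
    (h : rep x =ᵐ[volume.restrict (Icc a b)] u) {j : ℕ} (hj : j ≤ k) :
    der j x =ᵐ[volume.restrict (Icc a b)] iteratedDerivWithin j u (Icc a b) :=
  (isSobolev_rep x).ae_eq_iteratedDerivWithin hab hu h hj

theorem sobolev_ext {x y : sobolev hab p k} (h : rep x =ᵐ[volume.restrict (Icc a b)] rep y) :
    x = y := by
  apply Subtype.ext
  ext1 j
  apply Lp.ext
  exact (coe_ae_eq_der x j).trans
    ((der_ae_eq (isSobolev_rep y) h (Nat.lt_succ_iff.1 j.2)).trans (coe_ae_eq_der y j).symm)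

theorem rep_sobolevMk {u : ℝ → ℂ} (hu : IsSobolev a b p k u) :
    rep (sobolevMk hab hu) =ᵐ[volume.restrict (Icc a b)] u := by
  refine (coe_zero_ae_eq_rep _).symm.trans ?_
  have h : (sobolevMk hab hu).1 0 =ᵐ[volume.restrict (Icc a b)]
    iteratedDerivWithin ((0 : Fin (k + 1)) : ℕ) u (Icc a b) :=
    MemLp.coeFn_toLp (hu.memLp_iteratedDerivWithin hab (0 : Fin (k + 1)))
  simpa using h

theorem rep_add (x y : sobolev hab p k) :
    rep (x + y) =ᵐ[volume.restrict (Icc a b)] rep x + rep y := by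
  filter_upwards [coe_zero_ae_eq_rep x, coe_zero_ae_eq_rep y, coe_zero_ae_eq_rep (x + y),
    Lp.coeFn_add (x.1 0) (y.1 0)] with t h1 h2 h3 h4
  rw [Pi.add_apply, ← h1, ← h2, ← h3]
  exact h4

theorem rep_smul (z : ℂ) (x : sobolev hab p k) :
    rep (z • x) =ᵐ[volume.restrict (Icc a b)] z • rep x := by
  filter_upwards [coe_zero_ae_eq_rep x, coe_zero_ae_eq_rep (z • x),
    Lp.coeFn_smul z (x.1 0)] with t h1 h3 h4
  rw [Pi.smul_apply, ← h1, ← h3]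
  exact h4

theorem rep_zero : rep (0 : sobolev hab p k) =ᵐ[volume.restrict (Icc a b)] 0 := by
  filter_upwards [rep_smul 0 (0 : sobolev hab p k)] with t h
  simpa using h

theorem rep_sum {ι : Type*} (s : Finset ι) (x : ι → sobolev hab p k) :
    rep (∑ i ∈ s, x i) =ᵐ[volume.restrict (Icc a b)] ∑ i ∈ s, rep (x i) := by
  classical
  induction s using Finset.induction_on with
  | empty => simpa using rep_zero
  | insert i s hi ih =>
    rw [Finset.sum_insert hi, Finset.sum_insert hi]
    exact (rep_add _ _).trans (Filter.EventuallyEq.rfl.add ih)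

theorem continuousOn_rep (x : sobolev hab p (k + 1)) : ContinuousOn (rep x) (Icc a b) :=
  (isSobolev_rep x).continuousOn

theorem rep_eqOn {x : sobolev hab p (k + 1)} {u : ℝ → ℂ} (hu : ContinuousOn u (Icc a b))
    (h : rep x =ᵐ[volume.restrict (Icc a b)] u) : EqOn (rep x) u (Icc a b) :=
  eqOn_Icc_of_ae_eq hab (continuousOn_rep x) hu h

/-- This recursion for the norm drives the estimates by induction on the order. -/
theorem sobolev_norm_succ (x : sobolev hab p (k + 1)) (y : sobolev hab p k)
    (h : rep y =ᵐ[volume.restrict (Icc a b)] derivWithin (rep x) (Icc a b)) :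
    ‖x‖ = ‖y‖ + (eLpNorm (rep x) p (volume.restrict (Icc a b))).toReal := by
  rw [sobolev_norm_eq, sobolev_norm_eq, Finset.sum_range_succ']
  congr 1
  · refine Finset.sum_congr rfl fun j hj => ?_
    rw [eLpNorm_congr_ae (der_ae_eq ((isSobolev_rep x).derivWithin hab) h
      (Nat.lt_succ_iff.1 (Finset.mem_range.1 hj)))]
    congr 2
    funext t; rw [der, iteratedDerivWithin_succ']

theorem sobolev_norm_zero (x : sobolev hab p 0) :
    ‖x‖ = (eLpNorm (rep x) p (volume.restrict (Icc a b))).toReal := by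
  rw [sobolev_norm_eq, Finset.sum_range_one, der_zero]

theorem eLpNorm_rep_le (x : sobolev hab p k) :
    (eLpNorm (rep x) p (volume.restrict (Icc a b))).toReal ≤ ‖x‖ := by
  rw [sobolev_norm_eq, Finset.sum_range_succ']
  rw [der_zero]
  exact le_add_of_nonneg_left (Finset.sum_nonneg fun _ _ => ENNReal.toReal_nonneg)

/-- The operator `u ↦ u^{(j)}` from `W_p^k` to `W_p^l`, where `j + l ≤ k`. -/
noncomputable def sobolevDeriv (hab : a < b) (p : ℝ≥0∞) [Fact (1 ≤ p)] {k : ℕ} (j l : ℕ)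
    (h : j + l ≤ k) : sobolev hab p k →L[ℂ] sobolev hab p l :=
  LinearMap.mkContinuous
    { toFun := fun x => sobolevMk hab ((isSobolev_rep x).iteratedDerivWithin hab h)
      map_add' := fun x y => sobolev_ext (by
        refine (rep_sobolevMk _).trans (.trans ?_ (rep_add _ _).symm)
        refine (der_ae_eq ((isSobolev_rep x).add hab (isSobolev_rep y)) (rep_add x y)
          (by omega)).trans ?_
        refine ((isSobolev_rep x).ae_add hab (isSobolev_rep y) (by omega)).trans ?_
        exact (rep_sobolevMk _).symm.add (rep_sobolevMk _).symm)
      map_smul' := fun z x => sobolev_ext (by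
        refine (rep_sobolevMk _).trans (.trans ?_ (rep_smul _ _).symm)
        refine (der_ae_eq ((isSobolev_rep x).smul z) (rep_smul z x) (by omega)).trans ?_
        rw [iteratedDerivWithin_smul]
        exact (rep_sobolevMk _).symm.const_smul z) }
    1 (fun x => by
      rw [one_mul, sobolev_norm_eq, sobolev_norm_eq]
      have e : ∀ i ∈ Finset.range (l + 1),
          (eLpNorm (der i (sobolevMk hab ((isSobolev_rep x).iteratedDerivWithin hab h))) p
            (volume.restrict (Icc a b))).toReal =
          (eLpNorm (der (j + i) x) p (volume.restrict (Icc a b))).toReal := by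
        intro i hi
        rw [eLpNorm_congr_ae (der_ae_eq ((isSobolev_rep x).iteratedDerivWithin hab h)
          (rep_sobolevMk ((isSobolev_rep x).iteratedDerivWithin hab h))
          (Nat.lt_succ_iff.1 (Finset.mem_range.1 hi))), iteratedDerivWithin_iteratedDerivWithin,
          add_comm]
        rfl
      refine (Finset.sum_congr rfl e).trans_le ?_
      have := Finset.sum_Ico_eq_sum_range
        (fun i => (eLpNorm (der i x) p (volume.restrict (Icc a b))).toReal) j (j + l + 1)
      rw [show j + l + 1 - j = l + 1 by omega] at this
      rw [← this]
      refine Finset.sum_le_sum_of_subset_of_nonneg (fun i hi => ?_)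
        fun _ _ _ => ENNReal.toReal_nonneg
      rw [Finset.mem_Ico] at hi
      rw [Finset.mem_range]
      omega)

theorem rep_sobolevDeriv {j l : ℕ} (h : j + l ≤ k) (x : sobolev hab p k) :
    rep (sobolevDeriv hab p j l h x) =ᵐ[volume.restrict (Icc a b)] der j x :=
  rep_sobolevMk ((isSobolev_rep x).iteratedDerivWithin hab h)

theorem norm_sobolevDeriv_le {j l : ℕ} (h : j + l ≤ k) (x : sobolev hab p k) :
    ‖sobolevDeriv hab p j l h x‖ ≤ ‖x‖ := by
  have h1 : ‖sobolevDeriv hab p j l h‖ ≤ 1 := LinearMap.mkContinuous_norm_le _ zero_le_one _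
  simpa using (sobolevDeriv hab p j l h).le_of_opNorm_le h1 x

/-- Integrating `u(a) = u(s) - ∫_a^s u'` over `s` bounds `u(a)` by the `L_1` norms of `u` and `u'`;
then `u(t) = u(a) + ∫_a^t u'`, and `L_p` embeds in `L_1` on a bounded interval. -/
theorem exists_norm_rep_le (hab : a < b) (p : ℝ≥0∞) [Fact (1 ≤ p)] (k : ℕ) : ∃ C : ℝ, 0 ≤ C ∧
    ∀ (x : sobolev hab p (k + 1)), ∀ t ∈ Icc a b, ‖rep x t‖ ≤ C * ‖x‖ := by
  obtain ⟨C, hC, hC'⟩ := exists_integral_norm_le a b p (Fact.out : 1 ≤ p)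
  have hba : 0 < b - a := sub_pos.2 hab
  refine ⟨(C / (b - a) + C) + C, by positivity, fun x t ht => ?_⟩
  have h1 : (1 + k) ≤ k + 1 := by omega
  have hx := isSobolev_rep x
  have hx' := hx.derivWithin hab
  have hI : ∫ t in Icc a b, ‖derivWithin (rep x) (Icc a b) t‖ ≤ C * ‖x‖ := by
    refine (hC' _ (hx'.memLp hab)).trans (mul_le_mul_of_nonneg_left ?_ hC)
    rw [← der_one, ← eLpNorm_congr_ae (rep_sobolevDeriv h1 x)]
    exact (eLpNorm_rep_le _).trans (norm_sobolevDeriv_le h1 x)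
  have hF : ∀ s ∈ Icc a b, ‖∫ s in a..s, derivWithin (rep x) (Icc a b) s‖ ≤ C * ‖x‖ :=
    fun s hs => (norm_integral_le_integral_norm_Icc (hx'.integrable hab Fact.out) hs).trans hI
  have hA : ‖rep x a‖ * (b - a) ≤ C * ‖x‖ + C * ‖x‖ * (b - a) := by
    have h2 : ∫ t in Icc a b, ‖rep x a‖ ≤ ∫ t in Icc a b, (‖rep x t‖ + C * ‖x‖) := by
      refine setIntegral_mono_on (integrable_const _)
        ((hx.integrable hab Fact.out).norm.add (integrable_const _)) measurableSet_Icc ?_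
      intro s hs
      have := hx.eq_add_integral hab Fact.out hs
      calc ‖rep x a‖ = ‖rep x s - ∫ s in a..s, derivWithin (rep x) (Icc a b) s‖ := by
            rw [this]; congr 1; ring
        _ ≤ ‖rep x s‖ + ‖∫ s in a..s, derivWithin (rep x) (Icc a b) s‖ := norm_sub_le _ _
        _ ≤ _ := add_le_add_right (hF s hs) _
    rw [integral_add (hx.integrable hab Fact.out).norm (integrable_const _)] at h2
    simp only [integral_const, smul_eq_mul, measureReal_restrict_apply_univ,
      Real.volume_real_Icc_of_le hab.le] at h2
    have h3 := (hC' _ (hx.memLp hab)).trans (mul_le_mul_of_nonneg_left (eLpNorm_rep_le x) hC)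
    linarith
  have hA' : ‖rep x a‖ ≤ (C / (b - a) + C) * ‖x‖ := by
    have : (C / (b - a) + C) * ‖x‖ = (C * ‖x‖ + C * ‖x‖ * (b - a)) / (b - a) := by
      field_simp
    rw [this, le_div_iff₀ hba]
    exact hA
  rw [hx.eq_add_integral hab Fact.out ht, add_mul]
  exact (norm_add_le _ _).trans (add_le_add hA' (hF t ht))

/-- The value at the left endpoint, as a functional on `W_p^{k+1}`. -/
noncomputable def sobolevEval (hab : a < b) (p : ℝ≥0∞) [Fact (1 ≤ p)] (k : ℕ) :
    sobolev hab p (k + 1) →L[ℂ] ℂ :=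
  LinearMap.mkContinuous
    { toFun := fun x => rep x a
      map_add' := fun x y => rep_eqOn ((continuousOn_rep x).add (continuousOn_rep y))
        (rep_add x y) (left_mem_Icc.2 hab.le)
      map_smul' := fun z x => rep_eqOn ((continuousOn_rep x).const_smul z)
        (rep_smul z x) (left_mem_Icc.2 hab.le) }
    (exists_norm_rep_le hab p k).choose
    (fun x => (exists_norm_rep_le hab p k).choose_spec.2 x a (left_mem_Icc.2 hab.le))

theorem sobolevEval_apply (x : sobolev hab p (k + 1)) : sobolevEval hab p k x = rep x a := rfl

/-- The primitive of `g ∈ W_p^k` with value `c` at the left endpoint. -/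
noncomputable def sobolevPrim (g : sobolev hab p k) (c : ℂ) : sobolev hab p (k + 1) :=
  sobolevMk hab ((isSobolev_rep g).const_add_integral hab hp.out c)

theorem rep_sobolevPrim (g : sobolev hab p k) (c : ℂ) :
    EqOn (rep (sobolevPrim g c)) (fun t => c + ∫ s in a..t, rep g s) (Icc a b) :=
  rep_eqOn ((isSobolev_rep g).const_add_integral hab hp.out c).continuousOn (rep_sobolevMk _)

theorem sobolevEval_sobolevPrim (g : sobolev hab p k) (c : ℂ) :
    sobolevEval hab p k (sobolevPrim g c) = c := by
  rw [sobolevEval_apply, rep_sobolevPrim g c (left_mem_Icc.2 hab.le)]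
  simp

theorem derivWithin_sobolevPrim (g : sobolev hab p k) (c : ℂ) :
    derivWithin (rep (sobolevPrim g c)) (Icc a b) =ᵐ[volume.restrict (Icc a b)] rep g := by
  refine .trans ?_ (ae_derivWithin_integral hab c ((isSobolev_rep g).integrable hab hp.out))
  exact (ae_restrict_iff' measurableSet_Icc).2 (Eventually.of_forall fun t ht =>
    derivWithin_congr (rep_sobolevPrim g c) (rep_sobolevPrim g c ht))

theorem sobolevDeriv_sobolevPrim (g : sobolev hab p k) (c : ℂ) (h : 1 + k ≤ k + 1) :
    sobolevDeriv hab p 1 k h (sobolevPrim g c) = g := by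
  refine sobolev_ext ((rep_sobolevDeriv _ _).trans ?_)
  rw [der_one]
  exact derivWithin_sobolevPrim g c

theorem sobolevPrim_sobolevDeriv (x : sobolev hab p (k + 1)) (h : 1 + k ≤ k + 1) :
    sobolevPrim (sobolevDeriv hab p 1 k h x) (sobolevEval hab p k x) = x := by
  refine sobolev_ext ((ae_restrict_iff' measurableSet_Icc).2 (Eventually.of_forall fun t ht => ?_))
  rw [rep_sobolevPrim _ _ ht, (isSobolev_rep x).eq_add_integral hab hp.out ht,
    sobolevEval_apply]
  refine congrArg (rep x a + ·) (intervalIntegral.integral_congr_ae_restrict (μ := volume) ?_)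
  have h1 := rep_sobolevDeriv h x
  rw [der_one] at h1
  rw [uIoc_of_le ht.1]
  have hs : Ioc a t ⊆ Icc a b := fun s hs => ⟨hs.1.le, hs.2.trans ht.2⟩
  exact ae_restrict_of_ae_restrict_of_subset hs h1

theorem exists_norm_sobolevPrim_le (hab : a < b) (p : ℝ≥0∞) [Fact (1 ≤ p)] (k : ℕ) :
    ∃ C : ℝ, ∀ (g : sobolev hab p k) (c : ℂ), ‖sobolevPrim g c‖ ≤ C * (‖g‖ + ‖c‖) := by
  obtain ⟨C, hC, hC'⟩ := exists_integral_norm_le a b p (Fact.out : 1 ≤ p)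
  obtain ⟨D, hD, hD'⟩ := exists_eLpNorm_le_of_bound a b p
  refine ⟨1 + D * (C + 1), fun g c => ?_⟩
  rw [sobolev_norm_succ _ g (derivWithin_sobolevPrim g c).symm]
  have h1 : (eLpNorm (rep (sobolevPrim g c)) p (volume.restrict (Icc a b))).toReal
      ≤ D * (‖c‖ + C * ‖g‖) := by
    refine hD' _ _ (by positivity) fun t ht => ?_
    rw [rep_sobolevPrim g c ht]
    refine (norm_add_le _ _).trans (add_le_add_right ?_ _)
    have hg := isSobolev_rep g
    refine (norm_integral_le_integral_norm_Icc (hg.integrable hab Fact.out) ht).trans ?_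
    exact (hC' _ (hg.memLp hab)).trans (mul_le_mul_of_nonneg_left (eLpNorm_rep_le g) hC)
  have h2 : D * (‖c‖ + C * ‖g‖) ≤ D * ((C + 1) * (‖g‖ + ‖c‖)) := by
    refine mul_le_mul_of_nonneg_left ?_ hD
    nlinarith [norm_nonneg c, norm_nonneg g, mul_nonneg hC (norm_nonneg c)]
  nlinarith [norm_nonneg c]

/-- `W_p^{k+1} ≃ W_p^k × ℂ` through the derivative and the value at the left endpoint. -/
noncomputable def sobolevSuccEquiv (hab : a < b) (p : ℝ≥0∞) [Fact (1 ≤ p)] (k : ℕ) :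
    sobolev hab p (k + 1) ≃L[ℂ] sobolev hab p k × ℂ :=
  LinearEquiv.toContinuousLinearEquivOfBounds
    (LinearEquiv.ofBijective
      ((sobolevDeriv hab p 1 k (by omega)).prod (sobolevEval hab p k)).toLinearMap
      (Function.bijective_iff_has_inverse.2 ⟨fun q => sobolevPrim q.1 q.2,
        fun x => sobolevPrim_sobolevDeriv x _,
        fun q => Prod.ext (sobolevDeriv_sobolevPrim _ _ _) (sobolevEval_sobolevPrim _ _)⟩))
    ‖(sobolevDeriv hab p 1 k (by omega)).prod (sobolevEval hab p k)‖
    -- The factor 2 compares `‖g‖ + ‖c‖` with the maximum norm of the product; the absolute value is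
    -- there because the chosen constant carries no sign information.
    (2 * |(exists_norm_sobolevPrim_le hab p k).choose|)
    (fun x => ((sobolevDeriv hab p 1 k _).prod (sobolevEval hab p k)).le_opNorm x)
    (fun q => by
      have e : (LinearEquiv.ofBijective
          ((sobolevDeriv hab p 1 k (by omega)).prod (sobolevEval hab p k)).toLinearMap
          (Function.bijective_iff_has_inverse.2 ⟨fun q => sobolevPrim q.1 q.2,
            fun x => sobolevPrim_sobolevDeriv x _,
            fun q => Prod.ext (sobolevDeriv_sobolevPrim _ _ _)
              (sobolevEval_sobolevPrim _ _)⟩)).symm q = sobolevPrim q.1 q.2 := by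
        rw [LinearEquiv.symm_apply_eq]
        exact (Prod.ext (sobolevDeriv_sobolevPrim _ _ _) (sobolevEval_sobolevPrim _ _)).symm
      rw [e]
      refine ((exists_norm_sobolevPrim_le hab p k).choose_spec q.1 q.2).trans ?_
      rw [mul_comm 2, mul_assoc]
      refine (mul_le_mul_of_nonneg_right (le_abs_self _) (by positivity)).trans ?_
      refine mul_le_mul_of_nonneg_left ?_ (abs_nonneg _)
      rw [two_mul]
      exact add_le_add (norm_fst_le q) (norm_snd_le q))

theorem norm_coe_zero (x : sobolev hab p 0) : ‖x.1 0‖ = ‖x‖ := by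
  rw [sobolev_norm_zero, Lp.norm_def, eLpNorm_congr_ae (coe_zero_ae_eq_rep x)]

/-- Order 0 is isometric to `L_p`, and each further order adds a factor `ℂ` through
`sobolevSuccEquiv`. -/
instance completeSpace_sobolev : CompleteSpace (sobolev hab p k) := by
  induction k with
  | zero =>
    let e : sobolev hab p 0 ≃ᵢ Lp ℂ p (volume.restrict (Icc a b)) :=
      IsometryEquiv.mk' (fun x => x.1 0) (fun g => sobolevMk hab (k := 0) (Lp.memLp g))
        (fun g => Lp.ext ((coe_zero_ae_eq_rep _).trans (rep_sobolevMk _)))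
        (Isometry.of_dist_eq fun x y => by
          rw [dist_eq_norm, dist_eq_norm, ← norm_coe_zero]; rfl)
    exact e.completeSpace_iff.2 inferInstance
  | succ k ih =>
    exact (sobolevSuccEquiv hab p k).isUniformEmbedding.isUniformInducing.completeSpace_congr
      (sobolevSuccEquiv hab p k).surjective |>.2 inferInstance

end

/-! ### Multiplication between Sobolev spaces of consecutive orders. -/

section

variable {a b : ℝ} {hab : a < b} {p : ℝ≥0∞} [hp : Fact (1 ≤ p)] {n : ℕ}

/-- The product of `x ∈ W_p^n` and `y ∈ W_p^{n+1}`. -/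
noncomputable def sobolevMulAux (x : sobolev hab p n) (y : sobolev hab p (n + 1)) :
    sobolev hab p n :=
  sobolevMk hab ((isSobolev_rep x).mul_succ hab (isSobolev_rep y))

theorem rep_sobolevMulAux (x : sobolev hab p n) (y : sobolev hab p (n + 1)) :
    rep (sobolevMulAux x y) =ᵐ[volume.restrict (Icc a b)] rep x * rep y :=
  rep_sobolevMk _

/-- The factor `y` has one more derivative and is therefore bounded by its norm, which settles the
`L_p` part; the derivative of the product is handled by the Leibniz rule and induction. -/
theorem exists_norm_sobolevMulAux_le (hab : a < b) (p : ℝ≥0∞) [Fact (1 ≤ p)] (n : ℕ) :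
    ∃ C : ℝ, 0 ≤ C ∧ ∀ (x : sobolev hab p n) (y : sobolev hab p (n + 1)),
      ‖sobolevMulAux x y‖ ≤ C * ‖x‖ * ‖y‖ := by
  have hLp : ∀ n, ∃ C : ℝ, 0 ≤ C ∧ ∀ (x : sobolev hab p n) (y : sobolev hab p (n + 1)),
      (eLpNorm (rep (sobolevMulAux x y)) p (volume.restrict (Icc a b))).toReal
        ≤ C * ‖x‖ * ‖y‖ := by
    intro n
    obtain ⟨C, hC, hC'⟩ := exists_norm_rep_le hab p n
    refine ⟨C, hC, fun x y => ?_⟩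
    rw [eLpNorm_congr_ae (rep_sobolevMulAux x y)]
    refine (eLpNorm_mul_le_of_bound (by positivity) ((isSobolev_rep x).memLp hab) (hC' y)).trans ?_
    rw [mul_right_comm]
    have := eLpNorm_rep_le x
    gcongr
  induction n with
  | zero =>
    obtain ⟨C, hC, hC'⟩ := hLp 0
    exact ⟨C, hC, fun x y => by rw [sobolev_norm_zero]; exact hC' x y⟩
  | succ n ih =>
    obtain ⟨C, hC, hC'⟩ := hLp (n + 1)
    obtain ⟨D, hD, hD'⟩ := ih
    refine ⟨(D + D) + C, by positivity, fun x y => ?_⟩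
    have h1 : 1 + n ≤ n + 1 := by omega
    have h2 : 0 + n ≤ n + 1 := by omega
    have h3 : 1 + (n + 1) ≤ n + 1 + 1 := by omega
    have h4 : 0 + (n + 1) ≤ n + 1 + 1 := by omega
    -- `(xy)' = x'y + xy'`, where in each product the undifferentiated factor is viewed in a space
    -- of one order less, so that both fit the induction hypothesis.
    rw [sobolev_norm_succ _ (sobolevMulAux (sobolevDeriv hab p 1 n h1 x)
        (sobolevDeriv hab p 0 (n + 1) h4 y) + sobolevMulAux (sobolevDeriv hab p 0 n h2 x)
        (sobolevDeriv hab p 1 (n + 1) h3 y)) ?_]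
    · have e1 := hD' (sobolevDeriv hab p 1 n h1 x) (sobolevDeriv hab p 0 (n + 1) h4 y)
      have e2 := hD' (sobolevDeriv hab p 0 n h2 x) (sobolevDeriv hab p 1 (n + 1) h3 y)
      have b1 : ∀ (u : sobolev hab p n) (v : sobolev hab p (n + 1)), ‖u‖ ≤ ‖x‖ → ‖v‖ ≤ ‖y‖ →
          D * ‖u‖ * ‖v‖ ≤ D * ‖x‖ * ‖y‖ := fun u v hu hv => by gcongr
      have e1' := e1.trans (b1 _ _ (norm_sobolevDeriv_le h1 x) (norm_sobolevDeriv_le h4 y))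
      have e2' := e2.trans (b1 _ _ (norm_sobolevDeriv_le h2 x) (norm_sobolevDeriv_le h3 y))
      have := hC' x y
      have e3 := norm_add_le (sobolevMulAux (sobolevDeriv hab p 1 n h1 x)
        (sobolevDeriv hab p 0 (n + 1) h4 y)) (sobolevMulAux (sobolevDeriv hab p 0 n h2 x)
        (sobolevDeriv hab p 1 (n + 1) h3 y))
      linarith
    · have hx := isSobolev_rep x
      have hy := isSobolev_rep y
      have hm : derivWithin (rep (sobolevMulAux x y)) (Icc a b) =ᵐ[volume.restrict (Icc a b)]
          derivWithin (rep x * rep y) (Icc a b) := by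
        have := der_ae_eq (hx.mul_succ hab hy) (rep_sobolevMulAux x y) (j := 1) (by omega)
        have e : iteratedDerivWithin 1 (rep x * rep y) (Icc a b)
            = derivWithin (rep x * rep y) (Icc a b) := by
          funext t; rw [iteratedDerivWithin_one]
        rwa [der_one, e] at this
      filter_upwards [hm, ae_derivWithin_mul hab hx (hy.of_succ hab),
        rep_add (sobolevMulAux (sobolevDeriv hab p 1 n h1 x)
          (sobolevDeriv hab p 0 (n + 1) h4 y)) (sobolevMulAux (sobolevDeriv hab p 0 n h2 x)
          (sobolevDeriv hab p 1 (n + 1) h3 y)),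
        rep_sobolevMulAux (sobolevDeriv hab p 1 n h1 x) (sobolevDeriv hab p 0 (n + 1) h4 y),
        rep_sobolevMulAux (sobolevDeriv hab p 0 n h2 x) (sobolevDeriv hab p 1 (n + 1) h3 y),
        rep_sobolevDeriv h1 x, rep_sobolevDeriv h2 x, rep_sobolevDeriv h3 y,
        rep_sobolevDeriv h4 y] with t g1 g2 g3 g4 g5 g6 g7 g8 g9
      rw [g1, g2, g3]
      simp only [Pi.add_apply, Pi.mul_apply, g4, g5, g6, g7, g8, g9, der_zero, der_one]

/-- Multiplication `W_p^n × W_p^{n+1} → W_p^n`. -/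
noncomputable def sobolevMul (hab : a < b) (p : ℝ≥0∞) [Fact (1 ≤ p)] (n : ℕ) :
    sobolev hab p n →ₗ[ℂ] sobolev hab p (n + 1) →ₗ[ℂ] sobolev hab p n :=
  LinearMap.mk₂ ℂ sobolevMulAux
      (fun x x' y => sobolev_ext (by
        filter_upwards [rep_sobolevMulAux (x + x') y, rep_add (sobolevMulAux x y)
          (sobolevMulAux x' y), rep_sobolevMulAux x y, rep_sobolevMulAux x' y, rep_add x x']
          with t h1 h2 h3 h4 h5
        rw [h1, h2, Pi.mul_apply, h5, Pi.add_apply, Pi.add_apply, h3, h4]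
        exact add_mul _ _ _))
      (fun z x y => sobolev_ext (by
        filter_upwards [rep_sobolevMulAux (z • x) y, rep_smul z (sobolevMulAux x y),
          rep_sobolevMulAux x y, rep_smul z x] with t h1 h2 h3 h4
        rw [h1, h2, Pi.mul_apply, h4, Pi.smul_apply, Pi.smul_apply, h3]
        exact smul_mul_assoc _ _ _))
      (fun x y y' => sobolev_ext (by
        filter_upwards [rep_sobolevMulAux x (y + y'), rep_add (sobolevMulAux x y)
          (sobolevMulAux x y'), rep_sobolevMulAux x y, rep_sobolevMulAux x y', rep_add y y']
          with t h1 h2 h3 h4 h5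
        rw [h1, h2, Pi.mul_apply, h5, Pi.add_apply, Pi.add_apply, h3, h4]
        exact mul_add _ _ _))
      (fun z x y => sobolev_ext (by
        filter_upwards [rep_sobolevMulAux x (z • y), rep_smul z (sobolevMulAux x y),
          rep_sobolevMulAux x y, rep_smul z y] with t h1 h2 h3 h4
        rw [h1, h2, Pi.mul_apply, h4, Pi.smul_apply, Pi.smul_apply, h3]
        exact mul_smul_comm _ _ _))

theorem rep_sobolevMul (x : sobolev hab p n) (y : sobolev hab p (n + 1)) :
    rep (sobolevMul hab p n x y) =ᵐ[volume.restrict (Icc a b)] rep x * rep y :=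
  rep_sobolevMulAux x y

end

/-! ### Integral equations with an integrable Lipschitz constant. -/

section

variable {a b : ℝ}

theorem integral_exp_neg_mul_le {l : ℝ} (hl : 0 < l) (t : ℝ) :
    ∫ s in a..t, Real.exp (-(l * (t - s))) ≤ 1 / l := by
  have h : ∀ s ∈ uIcc a t, HasDerivAt (fun s => Real.exp (-(l * (t - s))) / l)
      (Real.exp (-(l * (t - s)))) s := by
    intro s _
    have h1 : HasDerivAt (fun s => -(l * (t - s))) l s := by
      convert! (((hasDerivAt_id s).const_sub t).const_mul l).neg using 1
      ring
    convert! h1.exp.div_const l using 1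
    field_simp
  rw [intervalIntegral.integral_eq_sub_of_hasDerivAt h
    ((by fun_prop : Continuous fun s => Real.exp (-(l * (t - s)))).intervalIntegrable _ _)]
  have : 0 ≤ Real.exp (-(l * (t - a))) / l := by positivity
  simpa using this

/-- Split `κ` into a part of `L_1` norm at most 1/4 and a bounded part. The exponential is at most 1
on the first and has integral at most `1 / l` against the second. -/
theorem exists_weight {κ : ℝ → ℝ} (hκ : Integrable κ (volume.restrict (Icc a b))) :
    ∃ l : ℝ, 0 < l ∧ ∀ t ∈ Icc a b, ∫ s in a..t, Real.exp (-(l * (t - s))) * κ s ≤ 1 / 2 := by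
  obtain ⟨g, hgs, hg, hgc, -⟩ :=
    hκ.exists_hasCompactSupport_integral_sub_le (show (0 : ℝ) < 1 / 4 by norm_num)
  obtain ⟨C, hC⟩ := hgc.bounded_above_of_compact_support hgs
  have hC0 : 0 ≤ C := (norm_nonneg _).trans (hC 0)
  -- Chosen so that `C / l ≤ 1/4`; the summand 1 keeps `l` positive when `C = 0`.
  refine ⟨4 * (C + 1), by positivity, fun t ht => ?_⟩
  have hl : 0 < 4 * (C + 1) := by positivity
  set l := 4 * (C + 1)
  have hsub : Ioc a t ⊆ Icc a b := fun s hs => ⟨hs.1.le, hs.2.trans ht.2⟩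
  have hI1 : IntervalIntegrable (fun s => ‖κ s - g s‖) volume a t := by
    rw [intervalIntegrable_iff_integrableOn_Ioc_of_le ht.1]
    exact IntegrableOn.mono_set (hκ.sub (hgc.continuousOn.integrableOn_Icc)).norm hsub
  have hI2 : IntervalIntegrable (fun s => C * Real.exp (-(l * (t - s)))) volume a t :=
    (by fun_prop : Continuous fun s => C * Real.exp (-(l * (t - s)))).intervalIntegrable _ _
  have hIκ : IntervalIntegrable (fun s => Real.exp (-(l * (t - s))) * κ s) volume a t := by
    refine IntervalIntegrable.continuousOn_mul ?_ (by fun_prop)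
    rw [intervalIntegrable_iff_integrableOn_Ioc_of_le ht.1]
    exact IntegrableOn.mono_set hκ hsub
  have h1 : ∫ s in a..t, Real.exp (-(l * (t - s))) * κ s
      ≤ ∫ s in a..t, (‖κ s - g s‖ + C * Real.exp (-(l * (t - s)))) := by
    refine intervalIntegral.integral_mono_on ht.1 hIκ (hI1.add hI2) fun s hs => ?_
    have he : Real.exp (-(l * (t - s))) ≤ 1 := by
      rw [Real.exp_le_one_iff, neg_nonpos]
      exact mul_nonneg hl.le (sub_nonneg.2 hs.2)
    have he0 := Real.exp_pos (-(l * (t - s)))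
    have e1 : Real.exp (-(l * (t - s))) * (κ s - g s) ≤ 1 * ‖κ s - g s‖ :=
      calc _ ≤ Real.exp (-(l * (t - s))) * ‖κ s - g s‖ :=
            mul_le_mul_of_nonneg_left (Real.le_norm_self _) he0.le
        _ ≤ _ := mul_le_mul_of_nonneg_right he (norm_nonneg _)
    have e2 : Real.exp (-(l * (t - s))) * g s ≤ Real.exp (-(l * (t - s))) * C :=
      mul_le_mul_of_nonneg_left ((Real.le_norm_self _).trans (hC s)) he0.le
    linarith
  have h2 : ∫ s in a..t, ‖κ s - g s‖ ≤ 1 / 4 := by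
    refine le_trans ?_ hg
    rw [intervalIntegral.integral_of_le ht.1]
    exact setIntegral_mono_set (hκ.sub (hgc.continuousOn.integrableOn_Icc)).norm
      (Eventually.of_forall fun _ => norm_nonneg _) (Eventually.of_forall hsub)
  rw [intervalIntegral.integral_add hI1 hI2, intervalIntegral.integral_const_mul] at h1
  have h3 : C * ∫ s in a..t, Real.exp (-(l * (t - s))) ≤ C * (1 / l) :=
    mul_le_mul_of_nonneg_left (integral_exp_neg_mul_le hl t) hC0
  have h4 : C * (1 / l) ≤ 1 / 4 := by
    rw [mul_one_div, div_le_iff₀ hl]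
    simp only [l]; linarith
  linarith

/-- Global existence for an integral equation of Carathéodory type with an integrable Lipschitz
constant. -/
theorem exists_integral_equation {E : Type*} [NormedAddCommGroup E] [NormedSpace ℝ E]
    [CompleteSpace E] (hab : a < b) {Φ : ℝ → E → E} {κ : ℝ → ℝ}
    (hκ : Integrable κ (volume.restrict (Icc a b)))
    (hΦ : ∀ z : ℝ → E, ContinuousOn z (Icc a b) →
      Integrable (fun s => Φ s (z s)) (volume.restrict (Icc a b)))
    (hκ0 : ∀ s, 0 ≤ κ s) (hlip : ∀ s x y, ‖Φ s x - Φ s y‖ ≤ κ s * ‖x - y‖) (z₀ : E) :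
    ∃ z : ℝ → E, ContinuousOn z (Icc a b) ∧
      ∀ t ∈ Icc a b, z t = z₀ + ∫ s in a..t, Φ s (z s) := by
  obtain ⟨l, hl, hw⟩ := exists_weight hκ
  -- The unknown is `z(s) = e^{l(s-a)} w(s)`: the sup norm of `w` is an exponentially weighted norm
  -- of `z`, for which the Picard map contracts on the whole interval at once.
  let ext : C(Icc a b, E) → ℝ → E := fun w s =>
    Real.exp (l * (s - a)) • w (projIcc a b hab.le s)
  have hext : ∀ w, Continuous (ext w) := fun w =>
    (by fun_prop : Continuous fun s => Real.exp (l * (s - a))).smul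
      (w.continuous.comp continuous_projIcc)
  have hint : ∀ w, IntegrableOn (fun s => Φ s (ext w s)) (Icc a b) := fun w =>
    hΦ _ (hext w).continuousOn
  have hcont : ∀ w, ContinuousOn (fun t => ∫ s in a..t, Φ s (ext w s)) (Icc a b) := fun w => by
    have := intervalIntegral.continuousOn_primitive_interval (a := a) (b := b) (μ := volume)
      (f := fun s => Φ s (ext w s)) (by rw [uIcc_of_le hab.le]; exact hint w)
    rwa [uIcc_of_le hab.le] at this
  let T : C(Icc a b, E) → C(Icc a b, E) := fun w =>
    ⟨fun t => Real.exp (-(l * (t - a))) • (z₀ + ∫ s in a..(t : ℝ), Φ s (ext w s)),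
      Continuous.smul (by fun_prop)
        (continuous_const.add (continuousOn_iff_continuous_domRestrict.1 (hcont w)))⟩
  have hT : ContractingWith (1 / 2) T := by
    refine ⟨by rw [← NNReal.coe_lt_coe]; norm_num, LipschitzWith.of_dist_le_mul fun v w => ?_⟩
    rw [ContinuousMap.dist_le (by positivity)]
    intro t
    have ht := t.2
    have hsub : Ioc a (t : ℝ) ⊆ Icc a b := fun s hs => ⟨hs.1.le, hs.2.trans ht.2⟩
    have hi : ∀ w, IntervalIntegrable (fun s => Φ s (ext w s)) volume a t := fun w => by
      rw [intervalIntegrable_iff_integrableOn_Ioc_of_le ht.1]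
      exact (hint w).mono_set hsub
    have hIκ : IntervalIntegrable (fun s => Real.exp (-(l * (t - s))) * κ s) volume a t := by
      refine IntervalIntegrable.continuousOn_mul ?_ (by fun_prop)
      rw [intervalIntegrable_iff_integrableOn_Ioc_of_le ht.1]
      exact IntegrableOn.mono_set hκ hsub
    have e : T v t - T w t = ∫ s in a..(t : ℝ),
        Real.exp (-(l * (t - a))) • (Φ s (ext v s) - Φ s (ext w s)) := by
      rw [intervalIntegral.integral_smul, intervalIntegral.integral_sub (hi v) (hi w)]
      simp only [T, ContinuousMap.coe_mk]
      rw [← smul_sub, add_sub_add_left_eq_sub]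
    rw [dist_eq_norm, e]
    refine (intervalIntegral.norm_integral_le_of_norm_le (g := fun s =>
      Real.exp (-(l * (t - s))) * κ s * dist v w) ht.1 (Eventually.of_forall fun s hs => ?_)
      (hIκ.mul_const _)).trans ?_
    · rw [norm_smul, Real.norm_of_nonneg (Real.exp_pos _).le]
      have h1 : ‖ext v s - ext w s‖ ≤ Real.exp (l * (s - a)) * dist v w := by
        simp only [ext]
        rw [← smul_sub, norm_smul, Real.norm_of_nonneg (Real.exp_pos _).le, ← dist_eq_norm]
        exact mul_le_mul_of_nonneg_left (ContinuousMap.dist_apply_le_dist _) (Real.exp_pos _).le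
      have h2 := hlip s (ext v s) (ext w s)
      have hexp : Real.exp (-(l * (t - s)))
          = Real.exp (-(l * (t - a))) * Real.exp (l * (s - a)) := by
        rw [← Real.exp_add]; congr 1; ring
      rw [hexp, mul_assoc, mul_assoc]
      refine mul_le_mul_of_nonneg_left (h2.trans ?_) (Real.exp_pos _).le
      rw [mul_left_comm]
      exact mul_le_mul_of_nonneg_left h1 (hκ0 s)
    · rw [intervalIntegral.integral_mul_const]
      exact (mul_le_mul_of_nonneg_right (hw t ht) dist_nonneg).trans (by simp)
  obtain ⟨w, hw'⟩ : ∃ w, T w = w := ⟨_, hT.fixedPoint_isFixedPt⟩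
  refine ⟨ext w, (hext w).continuousOn, fun t ht => ?_⟩
  have h := DFunLike.congr_fun hw' ⟨t, ht⟩
  simp only [T, ContinuousMap.coe_mk] at h
  simp only [ext]
  rw [projIcc_of_mem hab.le ht, ← h, smul_smul, ← Real.exp_add]
  simp [ext]

end

/-! ### Perturbation of operator pairs: norm convergence against strong convergence. -/

section

variable {ι : Type*} {l : Filter ι} {X Y F : Type*}
  [NormedAddCommGroup X] [NormedSpace ℂ X] [NormedAddCommGroup Y] [NormedSpace ℂ Y]
  [NormedAddCommGroup F] [NormedSpace ℂ F]

/-- If no eventual bound existed, countable generation of the filter would give a sequence tending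
to `l` with unbounded norms, although it converges pointwise; this contradicts Banach–Steinhaus. -/
theorem exists_eventually_norm_le [l.IsCountablyGenerated] [CompleteSpace X]
    {T : ι → X →L[ℂ] Y} {T₀ : X → Y} (hT : ∀ x, Tendsto (fun i => T i x) l (𝓝 (T₀ x))) :
    ∃ K : ℝ, ∀ᶠ i in l, ‖T i‖ ≤ K := by
  by_contra! h
  have hf : ∀ k : ℕ, ∃ᶠ i in l, (k : ℝ) < ‖T i‖ := fun k => h k
  obtain ⟨s, hs⟩ := l.exists_antitone_basis
  have : ∀ k : ℕ, ∃ i, i ∈ s k ∧ (k : ℝ) < ‖T i‖ := fun k => by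
    obtain ⟨i, hi, hi'⟩ := ((hf k).and_eventually (hs.1.mem_of_mem trivial)).exists
    exact ⟨i, hi', hi⟩
  choose u hu hu' using this
  have hul : Tendsto u atTop l := hs.tendsto hu
  obtain ⟨C, hC⟩ := banach_steinhaus (g := fun k => T (u k)) fun x => by
    obtain ⟨C, hC⟩ := ((hT x).comp hul).norm.bddAbove_range
    exact ⟨C, fun k => hC ⟨k, rfl⟩⟩
  obtain ⟨k, hk⟩ := exists_nat_gt C
  exact absurd ((hu' k).trans_le (hC k)) (not_lt.2 hk.le)

theorem eq_sum_smulRight {N : ℕ} (T : (Fin N → ℂ) →L[ℂ] Y) :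
    T = ∑ k, (ContinuousLinearMap.proj (R := ℂ) (φ := fun _ : Fin N => ℂ) k).smulRight
      (T (Pi.single k 1)) := by
  ext v
  conv_lhs => rw [pi_eq_sum_univ' v]
  simp

/-- The domain is finite-dimensional, so the operator is a continuous function of its finitely many
values on the basis. -/
theorem tendsto_clm_of_tendsto_apply {N : ℕ} {T : ι → (Fin N → ℂ) →L[ℂ] Y}
    {T₀ : (Fin N → ℂ) →L[ℂ] Y} (hT : ∀ x, Tendsto (fun i => T i x) l (𝓝 (T₀ x))) :
    Tendsto T l (𝓝 T₀) := by
  rw [eq_sum_smulRight T₀]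
  refine Tendsto.congr (fun i => (eq_sum_smulRight (T i)).symm) ?_
  refine tendsto_finsetSum _ fun k _ => ?_
  exact ((ContinuousLinearMap.smulRightL ℂ (Fin N → ℂ) Y
    (ContinuousLinearMap.proj (R := ℂ) (φ := fun _ : Fin N => ℂ) k)).continuous.tendsto _).comp
      (hT (Pi.single k 1))

theorem eventually_isUnit [CompleteSpace Y] {U : ι → Y →L[ℂ] Y} (hU : Tendsto U l (𝓝 1)) :
    ∀ᶠ i in l, IsUnit (U i) :=
  hU.eventually (Units.nhds (1 : (Y →L[ℂ] Y)ˣ))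

/-- Inversion is continuous at 1. The default value 0 of `Ring.inverse` at non-units plays no role,
since `U i` is eventually a unit. -/
theorem tendsto_of_tendsto_apply [CompleteSpace Y] {U : ι → Y →L[ℂ] Y} (hU : Tendsto U l (𝓝 1))
    {v : ι → Y} {h : Y} (hv : Tendsto (fun i => U i (v i)) l (𝓝 h)) : Tendsto v l (𝓝 h) := by
  have h1 : Tendsto (fun i => Ring.inverse (U i)) l (𝓝 (Ring.inverse 1)) :=
    (NormedRing.inverse_continuousAt (1 : (Y →L[ℂ] Y)ˣ)).tendsto.comp hU
  rw [Ring.inverse_one] at h1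
  have h2 := (isBoundedBilinearMap_apply.continuous.tendsto _).comp (h1.prodMk_nhds hv)
  refine Tendsto.congr' ?_ h2
  filter_upwards [eventually_isUnit hU] with i hi
  change (Ring.inverse (U i) * U i) (v i) = v i
  rw [Ring.inverse_mul_cancel _ hi]
  rfl

/-- Splits off the unipotent factor `1 + g`, with inverse `1 - g`; what remains is a perturbation of
1 that is small when `x` is small and `g` bounded. -/
theorem one_add_mul_one_add_one_sub_mul {R : Type*} [Ring R] {g : R} (hg : g * g = 0) (x : R) :
    (1 + g) * (1 + (1 - g) * x) = 1 + g + x := by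
  have : (1 + g) * (1 + (1 - g) * x) = 1 + g + x - g * g * x := by noncomm_ring
  rw [this, hg]; simp

theorem one_sub_mul_one_add_add {R : Type*} [Ring R] {g : R} (hg : g * g = 0) (x : R) :
    (1 - g) * (1 + g + x) = 1 + (1 - g) * x := by
  have : (1 - g) * (1 + g + x) = 1 + (1 - g) * x - g * g := by noncomm_ring
  rw [this, hg]; simp

theorem isUnit_one_add_of_mul_self_eq_zero {R : Type*} [Ring R] {g : R} (hg : g * g = 0) :
    IsUnit (1 + g) := by
  refine ⟨⟨1 + g, 1 - g, ?_, ?_⟩, rfl⟩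
  · have : (1 + g) * (1 - g) = 1 - g * g := by noncomm_ring
    rw [this, hg]; simp
  · have : (1 - g) * (1 + g) = 1 - g * g := by noncomm_ring
    rw [this, hg]; simp

/-- Stability of bijectivity and continuity of the solution for a pair of operators, the first
converging in norm and the second strongly. -/
theorem eventually_bijective_and_tendsto [l.IsCountablyGenerated] [CompleteSpace X]
    [CompleteSpace F] {N : ℕ} {L : ι → X →L[ℂ] F} {L₀ : X →L[ℂ] F}
    {B : ι → X →L[ℂ] (Fin N → ℂ)} {B₀ : X →L[ℂ] (Fin N → ℂ)}
    (h₀ : Function.Bijective (L₀.prod B₀)) (hL : Tendsto L l (𝓝 L₀))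
    (hB : ∀ x, Tendsto (fun i => B i x) l (𝓝 (B₀ x))) :
    (∀ᶠ i in l, Function.Bijective ((L i).prod (B i))) ∧
    ∀ (y : ι → X) (y₀ : X), Tendsto (fun i => L i (y i)) l (𝓝 (L₀ y₀)) →
      Tendsto (fun i => B i (y i)) l (𝓝 (B₀ y₀)) → Tendsto y l (𝓝 y₀) := by
  let e : X ≃L[ℂ] F × (Fin N → ℂ) := ContinuousLinearEquiv.ofBijective (L₀.prod B₀)
    (LinearMap.ker_eq_bot.2 h₀.1) (LinearMap.range_eq_top.2 h₀.2)
  have he : ∀ x, e x = (L₀ x, B₀ x) := fun x => rfl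
  let S : F × (Fin N → ℂ) →L[ℂ] X := e.symm
  have hS : ∀ q, (L₀ (S q), B₀ (S q)) = q := fun q => e.apply_symm_apply q
  let i₁ := ContinuousLinearMap.inl ℂ F (Fin N → ℂ)
  let i₂ := ContinuousLinearMap.inr ℂ F (Fin N → ℂ)
  let p₁ := ContinuousLinearMap.fst ℂ F (Fin N → ℂ)
  let p₂ := ContinuousLinearMap.snd ℂ F (Fin N → ℂ)
  -- `γ` is the block of `B i - B₀` acting on the `F`-component, which converges only strongly. Its
  -- counterpart `D` acts on a finite-dimensional space, so it converges in norm and can be put into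
  -- the small term `M`.
  let γ : ι → (F × (Fin N → ℂ)) →L[ℂ] (F × (Fin N → ℂ)) := fun i =>
    i₂ ∘L ((B i - B₀) ∘L S ∘L i₁) ∘L p₁
  let D : ι → (Fin N → ℂ) →L[ℂ] (Fin N → ℂ) := fun i => (B i - B₀) ∘L S ∘L i₂
  let M : ι → (F × (Fin N → ℂ)) →L[ℂ] (F × (Fin N → ℂ)) := fun i =>
    i₁ ∘L (L i - L₀) ∘L S + i₂ ∘L D i ∘L p₂
  let R : ι → (F × (Fin N → ℂ)) →L[ℂ] (F × (Fin N → ℂ)) := fun i => ((L i).prod (B i)) ∘L S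
  let U : ι → (F × (Fin N → ℂ)) →L[ℂ] (F × (Fin N → ℂ)) := fun i => 1 + (1 - γ i) * M i
  have hγγ : ∀ i, γ i * γ i = 0 := fun i => by
    refine ContinuousLinearMap.ext fun q => ?_
    change i₂ ((B i - B₀) (S (i₁ (0 : F)))) = 0
    simp only [map_zero]
  have hRM : ∀ i, R i = 1 + γ i + M i := fun i => by
    refine ContinuousLinearMap.ext fun q => ?_
    have hq : q = (q.1, 0) + (0, q.2) := by simp
    have hBS : B i (S q) = B i (S (q.1, 0)) + B i (S (0, q.2)) := by
      rw [← map_add, ← map_add, ← hq]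
    have hBS₀ : B₀ (S q) = B₀ (S (q.1, 0)) + B₀ (S (0, q.2)) := by
      rw [← map_add, ← map_add, ← hq]
    have h1 := congrArg Prod.fst (hS q)
    have h2 := congrArg Prod.snd (hS q)
    simp only at h1 h2
    refine Prod.ext ?_ ?_
    · simp [R, γ, M, i₁, i₂, p₁, p₂, D, h1]
    · change B i (S q) = q.2 + (B i (S (q.1, 0)) - B₀ (S (q.1, 0)))
        + (0 + (B i (S (0, q.2)) - B₀ (S (0, q.2))))
      have h3 : ∀ c x y u v : Fin N → ℂ, c = u + v → x + y = c + (x - u) + (0 + (y - v)) := by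
        rintro c x y u v rfl
        abel
      rw [hBS]
      exact h3 _ _ _ _ _ (h2.symm.trans hBS₀)
  have hRU : ∀ i, R i = (1 + γ i) * U i := fun i => by
    rw [hRM]; exact (one_add_mul_one_add_one_sub_mul (hγγ i) (M i)).symm
  have hUR : ∀ i, U i = (1 - γ i) * R i := fun i => by
    rw [hRM]; exact (one_sub_mul_one_add_add (hγγ i) (M i)).symm
  have hu : ∀ i, IsUnit (1 + γ i) := fun i => isUnit_one_add_of_mul_self_eq_zero (hγγ i)
  have hγ0 : ∀ q, Tendsto (fun i => γ i q) l (𝓝 0) := fun q => by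
    have h1 : Tendsto (fun i => B i (S (i₁ q.1)) - B₀ (S (i₁ q.1))) l (𝓝 0) := by
      simpa using (hB (S (i₁ q.1))).sub_const (B₀ (S (i₁ q.1)))
    have h2 := (i₂.continuous.tendsto 0).comp h1
    rw [map_zero] at h2
    exact h2
  -- Boundedness of `γ` suffices: in `U` it occurs only as the factor `1 - γ i` of the norm-small `M
  -- i`.
  obtain ⟨K, hK⟩ := exists_eventually_norm_le (T₀ := 0) hγ0
  have hM : Tendsto M l (𝓝 0) := by
    have hD : Tendsto D l (𝓝 0) := tendsto_clm_of_tendsto_apply fun x => by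
      simpa [D] using (hB (S (i₂ x))).sub_const (B₀ (S (i₂ x)))
    have hL' : Tendsto (fun i => L i - L₀) l (𝓝 0) := by simpa using hL.sub_const L₀
    have c1 : Continuous fun T : X →L[ℂ] F => i₁ ∘L T ∘L S := by fun_prop
    have c2 : Continuous fun T : (Fin N → ℂ) →L[ℂ] (Fin N → ℂ) => i₂ ∘L T ∘L p₂ := by fun_prop
    have := ((c1.tendsto 0).comp hL').add ((c2.tendsto 0).comp hD)
    rw [show (0 : (F × (Fin N → ℂ)) →L[ℂ] (F × (Fin N → ℂ))) = i₁ ∘L (0 : X →L[ℂ] F) ∘L S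
      + i₂ ∘L (0 : (Fin N → ℂ) →L[ℂ] (Fin N → ℂ)) ∘L p₂ by simp]
    exact this
  have hU : Tendsto U l (𝓝 1) := by
    have h1 : Tendsto (fun i => (1 - γ i) * M i) l (𝓝 0) := by
      refine squeeze_zero_norm'
        (a := fun i => (‖(1 : (F × (Fin N → ℂ)) →L[ℂ] (F × (Fin N → ℂ)))‖ + K) * ‖M i‖)
        ?_ ?_
      · filter_upwards [hK] with i hi
        refine (norm_mul_le _ _).trans (mul_le_mul_of_nonneg_right ?_ (norm_nonneg _))
        exact (norm_sub_le _ _).trans (add_le_add_right hi _)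
      · simpa using hM.norm.const_mul (‖(1 : (F × (Fin N → ℂ)) →L[ℂ] (F × (Fin N → ℂ)))‖ + K)
    simpa [U] using h1.const_add 1
  refine ⟨?_, fun y y₀ hy hy' => ?_⟩
  · filter_upwards [eventually_isUnit hU] with i hi
    have hR : IsUnit (R i) := by rw [hRU]; exact (hu i).mul hi
    have h1 : Function.Bijective (R i) := by
      obtain ⟨w, hw⟩ := hR
      rw [← hw]
      exact (ContinuousLinearEquiv.unitsEquiv ℂ _ w).bijective
    have h2 : ((L i).prod (B i) : X → F × (Fin N → ℂ)) = R i ∘ e := by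
      funext x
      simp [R, S]
    rw [h2]
    exact h1.comp e.bijective
  · have hw : Tendsto (fun i => e (y i)) l (𝓝 (e y₀)) := by
      refine tendsto_of_tendsto_apply hU ?_
      have h1 : Tendsto (fun i => (L i (y i), B i (y i))) l (𝓝 (e y₀)) := by
        rw [he]; exact hy.prodMk_nhds hy'
      have h2 : ∀ i, U i (e (y i)) = (L i (y i), B i (y i)) - γ i (L i (y i), B i (y i)) := by
        intro i
        rw [hUR]
        simp [R, S]
      simp only [h2]
      -- The argument of `γ i` varies: the bound `K` controls its deviation from `e y₀`, and strong
      -- convergence handles `e y₀` itself.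
      have h3 : Tendsto (fun i => γ i (L i (y i), B i (y i))) l (𝓝 0) := by
        have h4 : Tendsto (fun i => γ i ((L i (y i), B i (y i)) - e y₀)) l (𝓝 0) := by
          refine squeeze_zero_norm' (a := fun i => K * ‖(L i (y i), B i (y i)) - e y₀‖) ?_ ?_
          · filter_upwards [hK] with i hi
            exact (γ i).le_of_opNorm_le hi _
          · simpa using (h1.sub_const (e y₀)).norm.const_mul K
        simpa using h4.add (hγ0 (e y₀))
      simpa using h1.sub h3
    have h1 := (e.symm.continuous.tendsto _).comp hw
    simpa only [Function.comp_def, e.symm_apply_apply] using h1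

/-- Convergence of a coefficient `A` is recovered from convergence of solutions of
`d x + P A x = f` with fixed right-hand sides, if `A` is controlled by the values of `P A` at the
limit solutions. -/
theorem tendsto_coefficient {𝒜 κ : Type*} [NormedAddCommGroup 𝒜] [NormedSpace ℂ 𝒜] [Fintype κ]
    {P : 𝒜 →L[ℂ] X →L[ℂ] F} {d : X →L[ℂ] F} {y : κ → X} {C : ℝ} 
    (hP : ∀ A, ‖A‖ ≤ C * ∑ k, ‖P A (y k)‖) {A : ι → 𝒜} {A₀ : 𝒜} {x : ι → κ → X}
    (hx : ∀ k, Tendsto (fun i => x i k) l (𝓝 (y k)))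
    (h : ∀ᶠ i in l, ∀ k, d (x i k) + P (A i) (x i k) = d (y k) + P A₀ (y k)) :
    Tendsto A l (𝓝 A₀) := by
  let s : ι → ℝ := fun i => ∑ k, ‖x i k - y k‖
  have hs : Tendsto s l (𝓝 0) := by
    have : Tendsto s l (𝓝 (∑ k : κ, (0 : ℝ))) := tendsto_finsetSum _ fun k _ => by
      simpa using ((hx k).sub_const (y k)).norm
    simpa using this
  let D : ℝ := |C| * (‖d‖ + ‖P A₀‖)
  have key : ∀ᶠ i in l, ‖A i - A₀‖ ≤ |C| * ‖P‖ * s i * ‖A i - A₀‖ + D * s i := by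
    filter_upwards [h] with i hi
    have h1 : ∀ k, ‖P (A i - A₀) (y k)‖
        ≤ (‖P‖ * ‖A i - A₀‖ + ‖P A₀‖ + ‖d‖) * ‖x i k - y k‖ := fun k => by
      -- Difference of the two equations, with `x i k` written as `y k + (x i k - y k)`.
      have e : P (A i - A₀) (y k) = -(P (A i - A₀) (x i k - y k) + P A₀ (x i k - y k)
          + d (x i k - y k)) := by
        have := hi k
        simp only [map_sub, sub_apply]
        rw [← sub_eq_zero] at this ⊢
        rw [← this]; abel
      rw [e, norm_neg, add_mul, add_mul]
      refine (norm_add₃_le).trans (add_le_add (add_le_add ?_ ?_) ?_)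
      · exact P.le_opNorm₂ _ _
      · exact (P A₀).le_opNorm _
      · exact d.le_opNorm _
    have h2 : ∑ k, ‖P (A i - A₀) (y k)‖ ≤ (‖P‖ * ‖A i - A₀‖ + ‖P A₀‖ + ‖d‖) * s i := by
      rw [Finset.mul_sum]
      exact Finset.sum_le_sum fun k _ => h1 k
    calc ‖A i - A₀‖ ≤ C * ∑ k, ‖P (A i - A₀) (y k)‖ := hP _
      _ ≤ |C| * ∑ k, ‖P (A i - A₀) (y k)‖ :=
        mul_le_mul_of_nonneg_right (le_abs_self _) (Finset.sum_nonneg fun _ _ => norm_nonneg _)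
      _ ≤ |C| * ((‖P‖ * ‖A i - A₀‖ + ‖P A₀‖ + ‖d‖) * s i) :=
        mul_le_mul_of_nonneg_left h2 (abs_nonneg _)
      _ = _ := by simp only [D]; ring
  -- Once this factor is below 1/2, the unknown term on the right of `key` is absorbed into the
  -- left.
  have hsmall : ∀ᶠ i in l, |C| * ‖P‖ * s i < 1 / 2 := by
    have : Tendsto (fun i => |C| * ‖P‖ * s i) l (𝓝 0) := by simpa using hs.const_mul (|C| * ‖P‖)
    exact this.eventually (gt_mem_nhds (by norm_num))
  rw [tendsto_iff_norm_sub_tendsto_zero]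
  refine squeeze_zero' (g := fun i => 2 * D * s i) (Eventually.of_forall fun _ => norm_nonneg _)
    ?_ (by simpa using hs.const_mul (2 * D))
  filter_upwards [key, hsmall] with i h1 h2
  have := mul_le_mul_of_nonneg_right h2.le (norm_nonneg (A i - A₀))
  linarith

/-- Strong convergence of the boundary operators is recovered from continuity of the solution. -/
theorem tendsto_apply_of_continuity [l.NeBot] {N : ℕ} {L : ι → X →L[ℂ] F} {L₀ : X →L[ℂ] F}
    {B : ι → X →L[ℂ] (Fin N → ℂ)} {B₀ : X →L[ℂ] (Fin N → ℂ)}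
    (h₀ : Function.Bijective (L₀.prod B₀)) (hbij : ∀ᶠ i in l, Function.Bijective ((L i).prod (B i)))
    (hcont : ∀ (y : ι → X) (y₀ : X), Tendsto (fun i => L i (y i)) l (𝓝 (L₀ y₀)) →
      Tendsto (fun i => B i (y i)) l (𝓝 (B₀ y₀)) → Tendsto y l (𝓝 y₀)) {y : X}
    (hL : Tendsto (fun i => L i y) l (𝓝 (L₀ y))) :
    Tendsto (fun i => B i y) l (𝓝 (B₀ y)) := by
  have hsol : ∀ (f : ι → F) (f₀ : F) (c : Fin N → ℂ), Tendsto f l (𝓝 f₀) →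
      ∃ (x : ι → X) (x₀ : X), (∀ᶠ i in l, L i (x i) = f i ∧ B i (x i) = c) ∧
        L₀ x₀ = f₀ ∧ B₀ x₀ = c ∧ Tendsto x l (𝓝 x₀) := by
    intro f f₀ c hf
    obtain ⟨x₀, hx₀⟩ := h₀.2 (f₀, c)
    have h1 : L₀ x₀ = f₀ := congrArg Prod.fst hx₀
    have h2 : B₀ x₀ = c := congrArg Prod.snd hx₀
    have hex : ∀ᶠ i in l, ∃ x, L i x = f i ∧ B i x = c := by
      filter_upwards [hbij] with i hi
      obtain ⟨x, hx⟩ := hi.2 (f i, c)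
      exact ⟨x, congrArg Prod.fst hx, congrArg Prod.snd hx⟩
    obtain ⟨x, hx⟩ := hex.choice
    refine ⟨x, x₀, hx, h1, h2, hcont x x₀ ?_ ?_⟩
    · rw [h1]
      exact hf.congr' (hx.mono fun i hi => hi.1.symm)
    · rw [h2]
      exact tendsto_const_nhds.congr' (hx.mono fun i hi => hi.2.symm)
  obtain ⟨x, x₀, hx, hx1, hx2, hxt⟩ := hsol (fun i => L i y) (L₀ y) 0 hL
  choose Z Z₀ hZ hZ1 hZ2 hZt using fun k : Fin N =>
    hsol (fun _ => 0) 0 (Pi.single k 1) tendsto_const_nhds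
  -- The matrix with columns `B₀ (Z k i)`; it tends to 1 because `Z k i → Z₀ k` and `B₀ (Z₀ k)` is
  -- the `k`-th basis vector.
  let Θ : ι → (Fin N → ℂ) →L[ℂ] (Fin N → ℂ) := fun i =>
    ∑ k, (ContinuousLinearMap.proj (R := ℂ) (φ := fun _ : Fin N => ℂ) k).smulRight (B₀ (Z k i))
  have hΘ : Tendsto Θ l (𝓝 1) := by
    have h1 : (1 : (Fin N → ℂ) →L[ℂ] (Fin N → ℂ)) = ∑ k, (ContinuousLinearMap.proj (R := ℂ)
        (φ := fun _ : Fin N => ℂ) k).smulRight (B₀ (Z₀ k)) := by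
      conv_lhs => rw [eq_sum_smulRight 1]
      simp [hZ2]
    rw [h1]
    refine tendsto_finsetSum _ fun k _ => ?_
    exact ((ContinuousLinearMap.smulRightL ℂ (Fin N → ℂ) (Fin N → ℂ)
      (ContinuousLinearMap.proj (R := ℂ) (φ := fun _ : Fin N => ℂ) k)).continuous.tendsto _).comp
      ((B₀.continuous.tendsto _).comp (hZt k))
  refine tendsto_of_tendsto_apply hΘ ?_
  have h1 : Tendsto (fun i => B₀ (y - x i)) l (𝓝 (B₀ y)) := by
    have := (B₀.continuous.tendsto _).comp (hxt.const_sub y)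
    simpa [hx2, Function.comp_def] using this
  refine h1.congr' ?_
  filter_upwards [hbij, hx, eventually_all.2 hZ] with i hi hxi hZi
  -- Both sides are annihilated by `L i` and have boundary value `B i y`, so injectivity identifies
  -- them.
  have h2 : y - x i = ∑ k, B i y k • Z k i := by
    have e1 : L i (y - x i) = L i (∑ k, B i y k • Z k i) := by
      simp [hxi.1, hZi]
    have e2 : B i (y - x i) = B i (∑ k, B i y k • Z k i) := by
      simp only [map_sub, hxi.2, sub_zero, map_sum, map_smul, hZi]
      exact pi_eq_sum_univ' _
    exact hi.1 (Prod.ext e1 e2)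
  rw [h2]
  simp [Θ]

end

/-! ### The Cauchy problem in Sobolev spaces. -/

section

variable {a b : ℝ} {p : ℝ≥0∞}

theorem integrable_sum_mul {r m : ℕ} {α : Fin r → Fin m → ℝ → ℂ}
    (hα : ∀ l k, Integrable (α l k) (volume.restrict (Icc a b)))
    {u : Fin r → Fin m → ℝ → ℂ} (hu : ∀ l k, ContinuousOn (u l k) (Icc a b)) :
    Integrable (∑ l, ∑ k, α l k * u l k) (volume.restrict (Icc a b)) := by
  refine integrable_finsetSum' _ fun l _ => integrable_finsetSum' _ fun k _ => ?_
  exact memLp_one_iff_integrable.1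
    (memLp_mul_continuousOn (memLp_one_iff_integrable.2 (hα l k)) (hu l k))

/-- The companion system of a linear differential equation of order `q + 1` with integrable
coefficients, in integrated form. -/
theorem exists_companion_solution (hab : a < b) {q m : ℕ}
    {α : Fin (q + 1) → Fin m → Fin m → ℝ → ℂ}
    (hα : ∀ l i k, Integrable (α l i k) (volume.restrict (Icc a b)))
    {f : Fin m → ℝ → ℂ} (hf : ∀ i, Integrable (f i) (volume.restrict (Icc a b)))
    (c : Fin (q + 1) → Fin m → ℂ) :
    ∃ u : Fin (q + 1) → Fin m → ℝ → ℂ, (∀ j i, ContinuousOn (u j i) (Icc a b)) ∧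
      (∀ (j : Fin q) i, ∀ t ∈ Icc a b,
        u j.castSucc i t = c j.castSucc i + ∫ s in a..t, u j.succ i s) ∧
      (∀ i, ∀ t ∈ Icc a b, u (Fin.last q) i t = c (Fin.last q) i +
        ∫ s in a..t, (f i - ∑ l, ∑ k, α l i k * u l k) s) := by
  let Φ : ℝ → (Fin (q + 1) → Fin m → ℂ) → (Fin (q + 1) → Fin m → ℂ) := fun s z =>
    Fin.snoc (α := fun _ => Fin m → ℂ) (fun j : Fin q => z j.succ)
      (fun i => f i s - ∑ l, ∑ k, α l i k s * z l k)
  -- The 1 is the Lipschitz constant of the shift rows of the companion system; the sum covers its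
  -- last row.
  let κ : ℝ → ℝ := fun s => 1 + ∑ i, ∑ l, ∑ k, ‖α l i k s‖
  have hκ : Integrable κ (volume.restrict (Icc a b)) := by
    refine (integrable_const _).add (integrable_finsetSum _ fun i _ =>
      integrable_finsetSum _ fun l _ => integrable_finsetSum _ fun k _ => (hα l i k).norm)
  have hκ1 : ∀ s, 1 ≤ κ s := fun s => by
    refine le_add_of_nonneg_right ?_
    positivity
  have hlast : ∀ (z : ℝ → Fin (q + 1) → Fin m → ℂ), ContinuousOn z (Icc a b) → ∀ i,
      Integrable (f i - ∑ l, ∑ k, α l i k * fun s => z s l k) (volume.restrict (Icc a b)) :=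
    fun z hz i => (hf i).sub (integrable_sum_mul (fun l k => hα l i k) fun l k =>
      (continuous_apply k).comp_continuousOn ((continuous_apply l).comp_continuousOn hz))
  have hΦ : ∀ z : ℝ → Fin (q + 1) → Fin m → ℂ, ContinuousOn z (Icc a b) →
      Integrable (fun s => Φ s (z s)) (volume.restrict (Icc a b)) := by
    intro z hz
    refine Integrable.of_eval fun j => Integrable.of_eval fun i => ?_
    refine Fin.lastCases ?_ (fun j => ?_) j
    · refine (hlast z hz i).congr (Eventually.of_forall fun s => ?_)
      simp [Φ]
    · simp only [Φ, Fin.snoc_castSucc]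
      exact (((continuous_apply i).comp_continuousOn
        ((continuous_apply j.succ).comp_continuousOn hz)).integrableOn_Icc)
  have hlip : ∀ s x y, ‖Φ s x - Φ s y‖ ≤ κ s * ‖x - y‖ := by
    intro s x y
    have hxy : ∀ l k, ‖x l k - y l k‖ ≤ ‖x - y‖ := fun l k =>
      (norm_le_pi_norm ((x - y) l) k).trans (norm_le_pi_norm (x - y) l)
    have h0 : 0 ≤ κ s * ‖x - y‖ := mul_nonneg (zero_le_one.trans (hκ1 s)) (norm_nonneg _)
    refine (pi_norm_le_iff_of_nonneg h0).2 fun j => (pi_norm_le_iff_of_nonneg h0).2 fun i => ?_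
    refine Fin.lastCases ?_ (fun j => ?_) j
    · have e : (Φ s x - Φ s y) (Fin.last q) i = ∑ l, ∑ k, α l i k s * (y l k - x l k) := by
        simp only [Φ, Pi.sub_apply, Fin.snoc_last, mul_sub, Finset.sum_sub_distrib]
        ring
      rw [e]
      calc ‖∑ l, ∑ k, α l i k s * (y l k - x l k)‖
          ≤ ∑ l, ∑ k, ‖α l i k s‖ * ‖x - y‖ := by
            refine norm_sum_le_of_le _ fun l _ => norm_sum_le_of_le _ fun k _ => ?_
            rw [norm_mul, norm_sub_rev]
            exact mul_le_mul_of_nonneg_left (hxy l k) (norm_nonneg _)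
        _ = (∑ l, ∑ k, ‖α l i k s‖) * ‖x - y‖ := by simp only [Finset.sum_mul]
        _ ≤ κ s * ‖x - y‖ := by
            refine mul_le_mul_of_nonneg_right ?_ (norm_nonneg _)
            refine le_add_of_nonneg_of_le zero_le_one ?_
            exact Finset.single_le_sum (f := fun i => ∑ l, ∑ k, ‖α l i k s‖)
              (fun _ _ => by positivity) (Finset.mem_univ i)
    · simp only [Φ, Pi.sub_apply, Fin.snoc_castSucc]
      exact (hxy _ _).trans (le_mul_of_one_le_left (norm_nonneg _) (hκ1 s))
  obtain ⟨z, hz, hz'⟩ := exists_integral_equation hab hκ hΦ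
    (fun s => zero_le_one.trans (hκ1 s)) hlip c
  have hcoord : ∀ j i, ∀ t ∈ Icc a b, z t j i = c j i + ∫ s in a..t, Φ s (z s) j i := by
    intro j i t ht
    have hi : IntervalIntegrable (fun s => Φ s (z s)) volume a t := by
      rw [intervalIntegrable_iff_integrableOn_Ioc_of_le ht.1]
      exact IntegrableOn.mono_set (hΦ z hz) fun s hs => ⟨hs.1.le, hs.2.trans ht.2⟩
    have h1 := ContinuousLinearMap.intervalIntegral_comp_comm
      ((ContinuousLinearMap.proj (R := ℝ) (φ := fun _ : Fin m => ℂ) i) ∘L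
        (ContinuousLinearMap.proj (R := ℝ) (φ := fun _ : Fin (q + 1) => Fin m → ℂ) j)) hi
    have h2 := congrFun (congrFun (hz' t ht) j) i
    rw [h2, Pi.add_apply, Pi.add_apply]
    exact congrArg (c j i + ·) h1.symm
  refine ⟨fun j i t => z t j i, fun j i => (continuous_apply i).comp_continuousOn
    ((continuous_apply j).comp_continuousOn hz), fun j i t ht => ?_, fun i t ht => ?_⟩
  · refine (hcoord _ _ t ht).trans ?_
    simp [Φ]
  · refine (hcoord _ _ t ht).trans ?_
    simp [Φ]

theorem IsSobolev.sub (hab : a < b) {k : ℕ} {u v : ℝ → ℂ}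
    (hu : IsSobolev a b p k u) (hv : IsSobolev a b p k v) : IsSobolev a b p k (u - v) := by
  have := hu.add hab (hv.smul (-1))
  rwa [neg_one_smul, ← sub_eq_add_neg] at this

theorem IsSobolev.sum (hab : a < b) {k : ℕ} {ι : Type*} {s : Finset ι} {u : ι → ℝ → ℂ}
    (hu : ∀ i ∈ s, IsSobolev a b p k (u i)) : IsSobolev a b p k (∑ i ∈ s, u i) :=
  Finset.sum_induction _ _ (fun _ _ h h' => h.add hab h') (IsSobolev.zero a b p k) hu

/-- Solvability of the Cauchy problem in Sobolev spaces, at the level of functions. -/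
theorem exists_cauchy_solution (hab : a < b) (hp : 1 ≤ p) {q m n : ℕ}
    {α : Fin (q + 1) → Fin m → Fin m → ℝ → ℂ} (hα : ∀ l i k, IsSobolev a b p n (α l i k))
    {f : Fin m → ℝ → ℂ} (hf : ∀ i, IsSobolev a b p n (f i)) (c : Fin (q + 1) → Fin m → ℂ) :
    ∃ y : Fin m → ℝ → ℂ, (∀ i, IsSobolev a b p (n + (q + 1)) (y i)) ∧
      (∀ (j : Fin (q + 1)) i, iteratedDerivWithin j (y i) (Icc a b) a = c j i) ∧
      ∀ i, iteratedDerivWithin (q + 1) (y i) (Icc a b) =ᵐ[volume.restrict (Icc a b)]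
        f i - ∑ l : Fin (q + 1), ∑ k, α l i k * iteratedDerivWithin l (y k) (Icc a b) := by
  obtain ⟨u, hu, hu1, hu2⟩ := exists_companion_solution hab
    (fun l i k => (hα l i k).integrable hab hp) (fun i => (hf i).integrable hab hp) c
  let g : Fin m → ℝ → ℂ := fun i => f i - ∑ l, ∑ k, α l i k * u l k
  have hg : ∀ l ≤ n, (∀ j i, IsSobolev a b p l (u j i)) → ∀ i, IsSobolev a b p l (g i) := by
    intro l hl hul i
    refine ((hf i).mono hab hl).sub hab (IsSobolev.sum hab fun j _ => IsSobolev.sum hab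
      fun k _ => ?_)
    cases l with
    | zero => exact memLp_mul_continuousOn ((hα j i k).memLp hab) (hu j k)
    | succ l => exact ((hα j i k).mono hab hl).mul hab (hul j k)
  -- Bootstrap: each pass through the integral equations gains one order for all components, until
  -- the order `n` of the coefficients stops it.
  have hreg : ∀ l ≤ n + 1, ∀ j i, IsSobolev a b p l (u j i) := by
    intro l
    induction l with
    | zero => exact fun _ j i => memLp_of_continuousOn (hu j i)
    | succ l ih =>
      intro hl j i
      have h := ih (by omega)
      refine Fin.lastCases ?_ (fun j => ?_) j
      · exact ((hg l (by omega) h i).const_add_integral hab hp _).congr hab (hu2 i)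
      · exact ((h j.succ i).const_add_integral hab hp _).congr hab (hu1 j i)
  -- Descending from the last component, each `u j` is a primitive of `u (j+1)` and gains one more
  -- order, so `u 0` reaches `n + 1 + q`.
  have hreg' : ∀ (d : ℕ) (j : Fin (q + 1)), (j : ℕ) + d ≤ q → ∀ i,
      IsSobolev a b p (n + 1 + d) (u j i) := by
    intro d
    induction d with
    | zero => exact fun j _ i => hreg _ le_rfl j i
    | succ d ih =>
      intro j
      refine Fin.lastCases (fun h => ?_) (fun j h i => ?_) j
      · simp at h
      · have h1 := ih j.succ (by simp at h ⊢; omega) i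
        exact (h1.const_add_integral hab hp _).congr hab (hu1 j i)
  have hder : ∀ (j : ℕ) (hj : j < q + 1) (i : Fin m),
      EqOn (iteratedDerivWithin j (u 0 i) (Icc a b)) (u ⟨j, hj⟩ i) (Icc a b) := by
    intro j
    induction j with
    | zero => intro _ i t _; rw [iteratedDerivWithin_zero]; rfl
    | succ j ih =>
      intro hj i t ht
      have h1 := ih (by omega) i
      have h2 : EqOn (u ⟨j, by omega⟩ i)
          (fun t => c ⟨j, by omega⟩ i + ∫ s in a..t, u ⟨j + 1, hj⟩ i s) (Icc a b) :=
        hu1 ⟨j, by omega⟩ i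
      rw [iteratedDerivWithin_succ, derivWithin_congr (h1.trans h2) ((h1.trans h2) ht)]
      exact (hasDerivWithinAt_integral _ (hu ⟨j + 1, hj⟩ i) ht).derivWithin
        (uniqueDiffOn_Icc hab t ht)
  have ha : a ∈ Icc a b := left_mem_Icc.2 hab.le
  refine ⟨u 0, fun i => (hreg' q 0 (by simp) i).mono hab (by omega), fun j i => ?_, fun i => ?_⟩
  · rw [hder j j.2 i ha]
    refine Fin.lastCases ?_ (fun j => ?_) j
    · exact (hu2 i a ha).trans (by simp)
    · exact (hu1 j i a ha).trans (by simp)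
  · have hgi : Integrable (g i) (volume.restrict (Icc a b)) :=
      (hg 0 (Nat.zero_le n) (fun j i => memLp_of_continuousOn (hu j i)) i).integrable hab hp
    have h1 : EqOn (iteratedDerivWithin q (u 0 i) (Icc a b))
        (fun t => c (Fin.last q) i + ∫ s in a..t, g i s) (Icc a b) :=
      (hder q (by omega) i).trans (hu2 i)
    filter_upwards [ae_derivWithin_integral hab (c (Fin.last q) i) hgi,
      ae_restrict_mem measurableSet_Icc] with t h2 ht
    rw [iteratedDerivWithin_succ, derivWithin_congr h1 (h1 ht), h2]
    simp only [g, Pi.sub_apply, Finset.sum_apply, Pi.mul_apply]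
    congr 1
    refine Finset.sum_congr rfl fun l _ => Finset.sum_congr rfl fun k _ => ?_
    rw [hder l l.2 k ht]

end

/-! ### Dimension count and the abstract characterization of continuous dependence. -/

/-- If `(L, C)` is surjective, `(L, B)` is injective, and the targets of `B` and `C` have the same
finite dimension, then `(L, B)` is surjective. -/
theorem surjective_of_injective_prod {X F G H : Type*} [AddCommGroup X] [Module ℂ X]
    [AddCommGroup F] [Module ℂ F] [AddCommGroup G] [Module ℂ G] [AddCommGroup H] [Module ℂ H]
    [FiniteDimensional ℂ G] [FiniteDimensional ℂ H]
    (hGH : Module.finrank ℂ G = Module.finrank ℂ H)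
    {L : X →ₗ[ℂ] F} {B : X →ₗ[ℂ] G} {C : X →ₗ[ℂ] H} (hC : ∀ f c, ∃ x, L x = f ∧ C x = c)
    (hB : ∀ x, L x = 0 → B x = 0 → x = 0) (f : F) (g : G) : ∃ x, L x = f ∧ B x = g := by
  let B' := B.domRestrict (LinearMap.ker L)
  let C' := C.domRestrict (LinearMap.ker L)
  have hB' : Function.Injective B' := by
    rw [← LinearMap.ker_eq_bot, LinearMap.ker_eq_bot']
    intro x hx
    exact Subtype.ext (hB x x.2 hx)
  have hC' : Function.Surjective C' := fun c => by
    obtain ⟨x, h1, h2⟩ := hC 0 c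
    exact ⟨⟨x, h1⟩, h2⟩
  have : FiniteDimensional ℂ (LinearMap.ker L) := FiniteDimensional.of_injective B' hB'
  -- On `ker L` the map `B` is injective and `C` is onto, which bounds the dimension of the kernel
  -- from both sides.
  have hfin : Module.finrank ℂ (LinearMap.ker L) = Module.finrank ℂ G :=
    le_antisymm (LinearMap.finrank_le_finrank_of_injective hB')
      (hGH ▸ LinearMap.finrank_le_finrank_of_surjective hC')
  have hsurj := (LinearMap.injective_iff_surjective_of_finrank_eq_finrank hfin).1 hB'
  obtain ⟨x, hx, -⟩ := hC f 0
  obtain ⟨k, hk⟩ := hsurj (g - B x)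
  refine ⟨x + k, ?_, ?_⟩
  · rw [map_add, hx, k.2, add_zero]
  · have : B (k : X) = g - B x := hk
    rw [map_add, this, add_sub_cancel]

/-- The problems `L ε y = f`, `B ε y = c` are uniquely solvable for small `ε ≥ 0` and their
solutions are continuous in `ε` at `0`. -/
def SolutionContinuous {X F G : Type*} [TopologicalSpace X] [TopologicalSpace F]
    [TopologicalSpace G] (ε₀ : ℝ) (L : ℝ → X → F) (B : ℝ → X → G) : Prop :=
  ∃ ε₁ : ℝ, 0 < ε₁ ∧ ε₁ < ε₀ ∧
    (∀ ε ∈ Ico 0 ε₁, ∀ f c, ∃! y, L ε y = f ∧ B ε y = c) ∧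
    (∀ (f : ℝ → F) (c : ℝ → G) (y : ℝ → X),
      (∀ ε ∈ Ico 0 ε₁, L ε (y ε) = f ε ∧ B ε (y ε) = c ε) →
      Tendsto f (𝓝[>] 0) (𝓝 (f 0)) → Tendsto c (𝓝[>] 0) (𝓝 (c 0)) →
      Tendsto y (𝓝[>] 0) (𝓝 (y 0)))

section

variable {X F 𝒜 : Type*} [NormedAddCommGroup X] [NormedSpace ℂ X]
  [NormedAddCommGroup F] [NormedSpace ℂ F] [NormedAddCommGroup 𝒜] [NormedSpace ℂ 𝒜]

theorem bijective_prod_iff {N : ℕ} {L : X →L[ℂ] F} {B : X →L[ℂ] (Fin N → ℂ)} :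
    Function.Bijective (L.prod B) ↔ ∀ f c, ∃! y, L y = f ∧ B y = c := by
  rw [Function.bijective_iff_existsUnique, Prod.forall]
  simp only [ContinuousLinearMap.prod_apply, Prod.mk.injEq]

/-- Turns the quantifiers over `ε₁` and the data into statements along `𝓝[>] 0`. That filter ignores
`ε = 0`, so bijectivity there is a separate clause. -/
theorem solutionContinuous_iff {N : ℕ} {ε₀ : ℝ} (hε₀ : 0 < ε₀) {L : ℝ → X →L[ℂ] F}
    {B : ℝ → X →L[ℂ] (Fin N → ℂ)} :
    SolutionContinuous ε₀ (fun ε => L ε) (fun ε => B ε) ↔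
      Function.Bijective ((L 0).prod (B 0)) ∧
      (∀ᶠ ε in 𝓝[>] 0, Function.Bijective ((L ε).prod (B ε))) ∧
      ∀ (y : ℝ → X) (y₀ : X), Tendsto (fun ε => L ε (y ε)) (𝓝[>] 0) (𝓝 (L 0 y₀)) →
        Tendsto (fun ε => B ε (y ε)) (𝓝[>] 0) (𝓝 (B 0 y₀)) → Tendsto y (𝓝[>] 0) (𝓝 y₀) := by
  constructor
  · rintro ⟨ε₁, h1, -, hu, hc⟩
    refine ⟨bijective_prod_iff.2 (hu 0 ⟨le_rfl, h1⟩), ?_, fun y y₀ hL hB => ?_⟩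
    · filter_upwards [Ioo_mem_nhdsGT h1] with ε hε
      exact bijective_prod_iff.2 (hu ε ⟨hε.1.le, hε.2⟩)
    -- The definition takes the limit to be the member of the family at `ε = 0`, so `y₀` is inserted
    -- there; the limit along `𝓝[>] 0` does not see the change.
    · have hne : ∀ᶠ ε in 𝓝[>] (0 : ℝ), Function.update y 0 y₀ ε = y ε := by
        filter_upwards [self_mem_nhdsWithin] with ε hε
        exact Function.update_of_ne (ne_of_gt hε) _ _
      have h := hc (fun ε => L ε (Function.update y 0 y₀ ε))
        (fun ε => B ε (Function.update y 0 y₀ ε)) (Function.update y 0 y₀)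
        (fun _ _ => ⟨rfl, rfl⟩) ?_ ?_
      · rw [Function.update_self] at h
        exact h.congr' hne
      · simp only [Function.update_self]
        exact hL.congr' (hne.mono fun ε h => by simp only [h])
      · simp only [Function.update_self]
        exact hB.congr' (hne.mono fun ε h => by simp only [h])
  · rintro ⟨h0, hev, hc⟩
    obtain ⟨δ, hδ, hδ'⟩ := mem_nhdsGT_iff_exists_Ioo_subset.1 hev
    have hδ0 : (0 : ℝ) < δ := hδ
    -- Halving `ε₀` secures the strict inequality `ε₁ < ε₀`.
    refine ⟨min δ (ε₀ / 2), by positivity, (min_le_right _ _).trans_lt (by linarith),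
      fun ε hε => ?_, fun f c y hy hf hc' => ?_⟩
    · rw [← bijective_prod_iff]
      rcases hε.1.eq_or_lt with rfl | hpos
      · exact h0
      · exact hδ' ⟨hpos, hε.2.trans_le (min_le_left _ _)⟩
    · have hpos : 0 < min δ (ε₀ / 2) := by positivity
      have hy0 : L 0 (y 0) = f 0 ∧ B 0 (y 0) = c 0 := hy 0 ⟨le_rfl, hpos⟩
      have hev' : ∀ᶠ ε in 𝓝[>] (0 : ℝ), L ε (y ε) = f ε ∧ B ε (y ε) = c ε := by
        filter_upwards [Ioo_mem_nhdsGT hpos] with ε hε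
        exact hy ε ⟨hε.1.le, hε.2⟩
      refine hc y (y 0) ?_ ?_
      · rw [hy0.1]
        exact hf.congr' (hev'.mono fun ε h => h.1.symm)
      · rw [hy0.2]
        exact hc'.congr' (hev'.mono fun ε h => h.2.symm)

/-- Characterization of continuity of the solution for operators `d + P A` depending linearly on
a coefficient `A` that is controlled by finitely many values of `P A`. -/
theorem solutionContinuous_iff_tendsto [CompleteSpace X] [CompleteSpace F] {N : ℕ} {κ : Type*}
    [Fintype κ] {ε₀ : ℝ} (hε₀ : 0 < ε₀) {P : 𝒜 →L[ℂ] X →L[ℂ] F} {d : X →L[ℂ] F} {y : κ → X}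
    {C : ℝ} (hP : ∀ A, ‖A‖ ≤ C * ∑ k, ‖P A (y k)‖) {A : ℝ → 𝒜}
    {B : ℝ → X →L[ℂ] (Fin N → ℂ)}
    (hbij : (∀ y, (d + P (A 0)) y = 0 ∧ B 0 y = 0 → y = 0) →
      Function.Bijective ((d + P (A 0)).prod (B 0))) :
    SolutionContinuous ε₀ (fun ε => d + P (A ε)) (fun ε => B ε) ↔
      (∀ y, (d + P (A 0)) y = 0 ∧ B 0 y = 0 → y = 0) ∧ Tendsto A (𝓝[>] 0) (𝓝 (A 0)) ∧
        ∀ y, Tendsto (fun ε => B ε y) (𝓝[>] 0) (𝓝 (B 0 y)) := by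
  rw [solutionContinuous_iff hε₀ (L := fun ε => d + P (A ε))]
  have hcoef : Tendsto A (𝓝[>] 0) (𝓝 (A 0)) →
      Tendsto (fun ε => d + P (A ε)) (𝓝[>] 0) (𝓝 (d + P (A 0))) := fun h =>
    ((P.continuous.tendsto _).comp h).const_add d
  constructor
  · rintro ⟨h0, hev, hc⟩
    have hA : Tendsto A (𝓝[>] 0) (𝓝 (A 0)) := by
      -- The perturbed problems get the data that the test vectors `y k` have in the limit problem,
      -- so continuity brings their solutions back to `y k`.
      have hex : ∀ᶠ ε in 𝓝[>] (0 : ℝ), ∃ x : κ → X, ∀ k,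
          (d + P (A ε)) (x k) = (d + P (A 0)) (y k) ∧ B ε (x k) = B 0 (y k) := by
        filter_upwards [hev] with ε hε
        choose x hx using fun k => hε.2 ((d + P (A 0)) (y k), B 0 (y k))
        exact ⟨x, fun k => ⟨congrArg Prod.fst (hx k), congrArg Prod.snd (hx k)⟩⟩
      obtain ⟨x, hx⟩ := hex.choice
      refine tendsto_coefficient hP (d := d) (x := x) (fun k => ?_)
        (hx.mono fun ε h k => (h k).1)
      refine hc _ _ ?_ ?_
      · exact tendsto_const_nhds.congr' (hx.mono fun ε h => (h k).1.symm)
      · exact tendsto_const_nhds.congr' (hx.mono fun ε h => (h k).2.symm)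
    refine ⟨fun z hz => h0.1 ?_, hA, fun z => ?_⟩
    · rw [map_zero]
      exact Prod.ext hz.1 hz.2
    · refine tendsto_apply_of_continuity h0 hev hc ?_
      exact ((ContinuousLinearMap.apply ℂ F z).continuous.tendsto _).comp (hcoef hA)
  · rintro ⟨h0, hA, hB⟩
    exact ⟨hbij h0, eventually_bijective_and_tendsto (hbij h0) (hcoef hA) hB⟩

end

/-! ### Vector operators `T + ∑ A_j D_j` and recovery of their coefficients. -/

section

variable {V V₁ V₂ : Type*} [NormedAddCommGroup V] [NormedSpace ℂ V] [NormedAddCommGroup V₁]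
  [NormedSpace ℂ V₁] [NormedAddCommGroup V₂] [NormedSpace ℂ V₂] {m r : ℕ}

/-- The linear operator `y ↦ T y + ∑_j A_j (D_j y)` on vectors with entries in `V₂`, where the
entries of the coefficients `A_j` act through the bilinear map `μ`. -/
def vectorOp (μ : V →ₗ[ℂ] V₁ →ₗ[ℂ] V) (D : Fin r → V₂ →ₗ[ℂ] V₁) (T : V₂ →ₗ[ℂ] V)
    (A : Fin r → Fin m → Fin m → V) (y : Fin m → V₂) : Fin m → V :=
  fun i => T (y i) + ∑ j, ∑ k, μ (A j i k) (D j (y k))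

theorem exists_bilinear_clm {μ : V →ₗ[ℂ] V₁ →ₗ[ℂ] V} {D : Fin r → V₂ →ₗ[ℂ] V₁} {C : ℝ}
    (hC : 0 ≤ C) (hμ : ∀ x y, ‖μ x y‖ ≤ C * ‖x‖ * ‖y‖) (hD : ∀ j x, ‖D j x‖ ≤ ‖x‖) :
    ∃ P : (Fin r → Fin m → Fin m → V) →L[ℂ] (Fin m → V₂) →L[ℂ] (Fin m → V),
      ∀ A y i, P A y i = ∑ j, ∑ k, μ (A j i k) (D j (y k)) := by
  refine ⟨LinearMap.mkContinuous₂
    (LinearMap.mk₂ ℂ (fun A y i => ∑ j, ∑ k, μ (A j i k) (D j (y k)))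
      (fun A A' y => by funext i; simp [Finset.sum_add_distrib])
      (fun z A y => by funext i; simp [Finset.smul_sum])
      (fun A y y' => by funext i; simp [Finset.sum_add_distrib])
      (fun z A y => by funext i; simp [Finset.smul_sum]))
    (r * (m * C)) (fun A y => ?_), fun A y i => rfl⟩
  refine (pi_norm_le_iff_of_nonneg (by positivity)).2 fun i => ?_
  have h : ∀ j k, ‖μ (A j i k) (D j (y k))‖ ≤ C * ‖A‖ * ‖y‖ := fun j k => by
    refine (hμ _ _).trans ?_
    have h1 : ‖A j i k‖ ≤ ‖A‖ :=
      (norm_le_pi_norm (A j i) k).trans ((norm_le_pi_norm (A j) i).trans (norm_le_pi_norm A j))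
    have h2 := (hD j (y k)).trans (norm_le_pi_norm y k)
    gcongr
  change ‖∑ j, ∑ k, μ (A j i k) (D j (y k))‖ ≤ _
  refine (norm_sum_le_of_le _ fun j _ => norm_sum_le_of_le _ fun k _ => h j k).trans ?_
  simp only [Finset.sum_const, Finset.card_univ, Fintype.card_fin, nsmul_eq_mul]
  apply le_of_eq; ring

/-- The test vector supported in component `k` isolates the `k`-th columns. Terms with `j > l`
vanish and the term `j = l` is `A l i k` itself, so the system for the coefficients is triangular
with unit diagonal. -/
theorem sum_single_eq {μ : V →ₗ[ℂ] V₁ →ₗ[ℂ] V} {D : Fin r → V₂ →ₗ[ℂ] V₁} {e : Fin r → V₂}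
    (he : ∀ v l, μ v (D l (e l)) = v) (he' : ∀ j l, l < j → D j (e l) = 0)
    (A : Fin r → Fin m → Fin m → V) (l : Fin r) (k i : Fin m) :
    ∑ j, ∑ k', μ (A j i k') (D j ((Pi.single k (e l) : Fin m → V₂) k'))
      = A l i k + ∑ j ∈ Finset.univ.filter (· < l), μ (A j i k) (D j (e l)) := by
  have h1 : ∀ j, ∑ k', μ (A j i k') (D j ((Pi.single k (e l) : Fin m → V₂) k'))
      = μ (A j i k) (D j (e l)) := by
    intro j
    rw [Finset.sum_eq_single k]
    · rw [Pi.single_eq_same]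
    · intro k' _ hk
      rw [Pi.single_eq_of_ne hk, map_zero, map_zero]
    · simp
  rw [Finset.sum_congr rfl fun j _ => h1 j,
    ← Finset.sum_filter_add_sum_filter_not Finset.univ (· < l), add_comm (A l i k)]
  congr 1
  rw [Finset.sum_eq_single l]
  · exact he _ l
  · intro j hj hjl
    rw [he' j l (lt_of_le_of_ne (not_lt.1 (Finset.mem_filter.1 hj).2) hjl.symm), map_zero]
  · intro h
    simp at h

/-- Forward substitution in the triangular system: `A l` is a value of `P A` minus terms in the `A
j` with `j < l`, which are already bounded. -/
theorem exists_norm_le_sum {μ : V →ₗ[ℂ] V₁ →ₗ[ℂ] V} {D : Fin r → V₂ →ₗ[ℂ] V₁} {K : ℝ}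
    (hK : 0 ≤ K) (hμ : ∀ x y, ‖μ x y‖ ≤ K * ‖x‖ * ‖y‖) {e : Fin r → V₂}
    (he : ∀ v l, μ v (D l (e l)) = v) (he' : ∀ j l, l < j → D j (e l) = 0)
    {P : (Fin r → Fin m → Fin m → V) →L[ℂ] (Fin m → V₂) →L[ℂ] (Fin m → V)}
    (hP : ∀ A y i, P A y i = ∑ j, ∑ k, μ (A j i k) (D j (y k))) :
    ∃ C : ℝ, ∀ A, ‖A‖ ≤ C * ∑ q : Fin r × Fin m, ‖P A (Pi.single q.2 (e q.1))‖ := by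
  let σ : (Fin r → Fin m → Fin m → V) → ℝ := fun A =>
    ∑ q : Fin r × Fin m, ‖P A (Pi.single q.2 (e q.1))‖
  have hσ : ∀ A, 0 ≤ σ A := fun A => Finset.sum_nonneg fun _ _ => norm_nonneg _
  have key : ∀ l : Fin r, ∃ C : ℝ, 0 ≤ C ∧ ∀ A i k, ‖A l i k‖ ≤ C * σ A := by
    intro l
    induction l using WellFoundedLT.induction with
    | ind l ih =>
    choose! C hC hC' using ih
    refine ⟨1 + ∑ j ∈ Finset.univ.filter (· < l), C j * (K * ‖D j (e l)‖), ?_, fun A i k => ?_⟩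
    · refine add_nonneg zero_le_one (Finset.sum_nonneg fun j hj => ?_)
      exact mul_nonneg (hC j (Finset.mem_filter.1 hj).2) (by positivity)
    · rw [eq_sub_of_add_eq (sum_single_eq he he' A l k i).symm, ← hP, add_mul, one_mul,
        Finset.sum_mul]
      refine (norm_sub_le _ _).trans (add_le_add ?_ (norm_sum_le_of_le _ fun j hj => ?_))
      · refine (norm_le_pi_norm (P A (Pi.single k (e l))) i).trans ?_
        exact Finset.single_le_sum (f := fun q : Fin r × Fin m => ‖P A (Pi.single q.2 (e q.1))‖)
          (fun _ _ => norm_nonneg _) (Finset.mem_univ (l, k))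
      · refine (hμ _ _).trans ?_
        have h1 := hC' j (Finset.mem_filter.1 hj).2 A i k
        calc _ ≤ K * (C j * σ A) * ‖D j (e l)‖ := by gcongr
          _ = _ := by ring
  choose C hC hC' using key
  refine ⟨∑ l, C l, fun A => ?_⟩
  have h0 : 0 ≤ (∑ l, C l) * σ A := mul_nonneg (Finset.sum_nonneg fun l _ => hC l) (hσ A)
  refine (pi_norm_le_iff_of_nonneg h0).2 fun l => (pi_norm_le_iff_of_nonneg h0).2 fun i =>
    (pi_norm_le_iff_of_nonneg h0).2 fun k => (hC' l A i k).trans ?_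
  exact mul_le_mul_of_nonneg_right
    (Finset.single_le_sum (fun l _ => hC l) (Finset.mem_univ l)) (hσ A)

theorem solutionContinuous_vectorOp_iff [CompleteSpace V] [CompleteSpace V₂] {ε₀ : ℝ}
    (hε₀ : 0 < ε₀) {μ : V →ₗ[ℂ] V₁ →ₗ[ℂ] V} {D : Fin r → V₂ →ₗ[ℂ] V₁} {T : V₂ →ₗ[ℂ] V} {K : ℝ}
    (hK : 0 ≤ K) (hμ : ∀ x y, ‖μ x y‖ ≤ K * ‖x‖ * ‖y‖) (hD : ∀ j x, ‖D j x‖ ≤ ‖x‖)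
    (hT : ∀ x, ‖T x‖ ≤ ‖x‖) {e : Fin r → V₂}
    (he : ∀ v l, μ v (D l (e l)) = v) (he' : ∀ j l, l < j → D j (e l) = 0)
    {η : (Fin m → V₂) →ₗ[ℂ] (Fin r → Fin m → ℂ)}
    (hη : ∀ A f c, ∃ y, vectorOp μ D T A y = f ∧ η y = c)
    {A : ℝ → Fin r → Fin m → Fin m → V} {B : ℝ → (Fin m → V₂) →L[ℂ] (Fin (r * m) → ℂ)} :
    SolutionContinuous ε₀ (fun ε => vectorOp μ D T (A ε)) (fun ε => B ε) ↔
      (∀ y, vectorOp μ D T (A 0) y = 0 ∧ B 0 y = 0 → y = 0) ∧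
        Tendsto A (𝓝[>] 0) (𝓝 (A 0)) ∧
        ∀ y, Tendsto (fun ε => B ε y) (𝓝[>] 0) (𝓝 (B 0 y)) := by
  obtain ⟨P, hP⟩ := exists_bilinear_clm (m := m) hK hμ hD
  obtain ⟨C, hC⟩ := exists_norm_le_sum hK hμ he he' hP
  let d : (Fin m → V₂) →L[ℂ] (Fin m → V) := ContinuousLinearMap.pi fun i =>
    (T.mkContinuous 1 fun x => by simpa using hT x).comp (ContinuousLinearMap.proj i)
  have hop : ∀ A, vectorOp μ D T A = (d + P A : (Fin m → V₂) →L[ℂ] (Fin m → V)) := by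
    intro A
    funext y i
    have h : (d + P A) y i = T (y i) + P A y i := rfl
    rw [h, hP]
    rfl
  have key := solutionContinuous_iff_tendsto hε₀ hC (d := d) (A := A) (B := B) ?_
  · simpa only [hop] using key
  · intro h0
    rw [bijective_prod_iff]
    intro f c
    obtain ⟨y, h1, h2⟩ := surjective_of_injective_prod (L := (d + P (A 0)).toLinearMap)
      -- `η` plays the role of the Cauchy data; its target and that of `B 0` both have dimension `r
      -- * m`.
      (B := (B 0).toLinearMap) (C := η) (by simp [Module.finrank_pi_fintype])
      (fun f c => by
        obtain ⟨y, hy, hy'⟩ := hη (A 0) f c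
        exact ⟨y, (congrFun (hop (A 0)) y).symm.trans hy, hy'⟩)
      (fun y hy hy' => h0 y ⟨hy, hy'⟩) f c
    refine ⟨y, ⟨h1, h2⟩, fun z hz => ?_⟩
    have h3 : (d + P (A 0)) (z - y) = 0 := by
      rw [map_sub, hz.1, sub_eq_zero]; exact h1.symm
    have h4 : B 0 (z - y) = 0 := by
      rw [map_sub, hz.2, sub_eq_zero]; exact h2.symm
    exact sub_eq_zero.1 (h0 _ ⟨h3, h4⟩)

end

/-! ### Monomial test functions and the concrete differential operator. -/

/-- The function `t ↦ t^l / l!`. -/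
noncomputable def monomialFun (l : ℕ) (t : ℝ) : ℂ := (t : ℂ) ^ l / (l.factorial : ℂ)

theorem hasDerivAt_monomialFun (l : ℕ) (t : ℝ) :
    HasDerivAt (monomialFun (l + 1)) (monomialFun l t) t := by
  have h := ((hasDerivAt_id t).ofReal_comp.pow (l + 1)).div_const ((l + 1).factorial : ℂ)
  convert! h using 1
  rw [monomialFun, Nat.factorial_succ]
  have h1 : (l.factorial : ℂ) ≠ 0 := by exact_mod_cast l.factorial_ne_zero
  have h2 : ((l : ℂ) + 1) ≠ 0 := by exact_mod_cast l.succ_ne_zero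
  push_cast
  field_simp
  simp

/-- Indexing the order as `l + d` lets one induction on `l` cover both the derivative of order `l`
and the vanishing higher ones. -/
theorem iteratedDerivWithin_monomialFun {a b : ℝ} (hab : a < b) (l d : ℕ) :
    EqOn (iteratedDerivWithin (l + d) (monomialFun l) (Icc a b))
      (fun _ => if d = 0 then 1 else 0) (Icc a b) := by
  induction l with
  | zero =>
    intro t _
    have : monomialFun 0 = fun _ => (1 : ℂ) := by funext t; simp [monomialFun]
    rw [this, zero_add, iteratedDerivWithin_const]
  | succ l ih =>
    intro t ht
    rw [add_right_comm, iteratedDerivWithin_succ', ← ih ht]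
    exact iteratedDerivWithin_congr (fun s hs => (hasDerivAt_monomialFun l s).hasDerivWithinAt
      |>.derivWithin (uniqueDiffOn_Icc hab s hs)) ht

theorem isSobolev_monomialFun {p : ℝ≥0∞} {a b : ℝ} (hab : a < b) (k l : ℕ) :
    IsSobolev a b p k (monomialFun l) :=
  isSobolev_of_contDiff hab ((Complex.ofRealCLM.contDiff.pow l).div_const _)

section

variable {a b : ℝ} {hab : a < b} {p : ℝ≥0∞} [hp : Fact (1 ≤ p)] {m n r : ℕ}

/-- The differential operator `y ↦ y^{(r)} + ∑_{j < r} A_j y^{(j)}` from `(W_p^{n+r})^m` to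
`(W_p^n)^m`. -/
noncomputable def diffOp (A : Fin r → Fin m → Fin m → sobolev hab p n) :
    (Fin m → sobolev hab p (n + r)) → Fin m → sobolev hab p n :=
  vectorOp (sobolevMul hab p n)
    -- Since `j < r`, the derivative `y^(j)` lies in `W_p^{n+1}`, the order that multiplication by a
    -- `W_p^n` coefficient requires.
    (fun j : Fin r => (sobolevDeriv hab p j (n + 1) (by omega)).toLinearMap)
    (sobolevDeriv hab p r n (by omega)).toLinearMap A

theorem diffExpr_apply (A : Fin r → Matrix (Fin m) (Fin m) (sobolev hab p n))
    (y : Fin m → sobolev hab p (n + r)) (t : ℝ) (i : Fin m) :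
    diffExpr A y t i = der r (y i) t + ∑ j : Fin r, ∑ k, rep (A j i k) t * der j (y k) t := by
  simp [diffExpr, Matrix.mulVec, dotProduct, Finset.sum_apply, der_zero]

theorem rep_diffOp (A : Fin r → Matrix (Fin m) (Fin m) (sobolev hab p n))
    (y : Fin m → sobolev hab p (n + r)) (i : Fin m) :
    rep (diffOp A y i) =ᵐ[volume.restrict (Icc a b)] fun t => diffExpr A y t i := by
  have h1 := rep_add (sobolevDeriv hab p r n (by omega) (y i))
    (∑ j : Fin r, ∑ k, sobolevMul hab p n (A j i k)
      (sobolevDeriv hab p j (n + 1) (by omega) (y k)))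
  have h2 := rep_sobolevDeriv (j := r) (l := n) (by omega) (y i)
  have h3 := rep_sum Finset.univ fun j : Fin r => ∑ k, sobolevMul hab p n (A j i k)
    (sobolevDeriv hab p j (n + 1) (by omega) (y k))
  have h4 := eventually_all.2 fun j : Fin r => rep_sum Finset.univ fun k =>
    sobolevMul hab p n (A j i k) (sobolevDeriv hab p j (n + 1) (by omega) (y k))
  have h5 := eventually_all.2 fun j : Fin r => eventually_all.2 fun k =>
    rep_sobolevMul (A j i k) (sobolevDeriv hab p j (n + 1) (by omega) (y k))
  have h6 := eventually_all.2 fun j : Fin r => eventually_all.2 fun k =>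
    rep_sobolevDeriv (j := j) (l := n + 1) (by omega) (y k)
  filter_upwards [h1, h2, h3, h4, h5, h6] with t g1 g2 g3 g4 g5 g6
  refine g1.trans ?_
  rw [Pi.add_apply, g2, g3, diffExpr_apply, Finset.sum_apply]
  congr 1
  refine Finset.sum_congr rfl fun j _ => ?_
  rw [g4 j, Finset.sum_apply]
  refine Finset.sum_congr rfl fun k _ => ?_
  rw [g5 j k, Pi.mul_apply, g6 j k]

theorem continuousOn_der {k : ℕ} (x : sobolev hab p k) {j : ℕ} (hj : j < k) :
    ContinuousOn (der j x) (Icc a b) :=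
  ((isSobolev_rep x).iteratedDerivWithin hab (j := j) (l := 0 + 1) (by omega)).continuousOn

theorem diffOp_eq_iff_ae (A : Fin r → Matrix (Fin m) (Fin m) (sobolev hab p n))
    (y : Fin m → sobolev hab p (n + r)) (f : Fin m → sobolev hab p n) :
    diffOp A y = f ↔ ∀ᵐ t ∂(volume.restrict (Icc a b)),
      diffExpr A y t = fun i => der 0 (f i) t := by
  constructor
  · rintro rfl
    filter_upwards [eventually_all.2 (rep_diffOp A y)] with t ht
    funext i
    simp only [der_zero, ht i]
  · intro h
    funext i
    refine sobolev_ext ((rep_diffOp A y i).trans ?_)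
    filter_upwards [h] with t ht
    rw [ht]
    simp only [der_zero]

/-- For `n ≥ 1` both sides of the equation are continuous, so the pointwise and the a.e.
formulations agree. -/
theorem isSolution_iff (A : Fin r → Matrix (Fin m) (Fin m) (sobolev hab p n))
    (B : (Fin m → sobolev hab p (n + r)) →L[ℂ] (Fin (r * m) → ℂ))
    (f : Fin m → sobolev hab p n) (c : Fin (r * m) → ℂ) (y : Fin m → sobolev hab p (n + r)) :
    IsSolution A B f c y ↔ diffOp A y = f ∧ B y = c := by
  refine and_congr_left fun _ => ?_
  rw [diffOp_eq_iff_ae, restrict_Ioo_eq_restrict_Icc]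
  split_ifs with hn
  · rfl
  · obtain ⟨n, rfl⟩ := Nat.exists_eq_succ_of_ne_zero hn
    constructor
    · intro h
      filter_upwards [ae_mem_Ioo] with t ht using h t ht
    · intro h t ht
      funext i
      have hc1 : ContinuousOn (fun t => diffExpr A y t i) (Icc a b) := by
        simp only [diffExpr_apply]
        refine (continuousOn_der _ (by omega)).add (continuousOn_finsetSum _ fun j _ =>
          continuousOn_finsetSum _ fun k _ => (continuousOn_rep _).mul (continuousOn_der _ ?_))
        have := j.2
        omega
      have hc2 : ContinuousOn (fun t => der 0 (f i) t) (Icc a b) :=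
        continuousOn_der _ (Nat.succ_pos n)
      exact eqOn_Icc_of_ae_eq hab hc1 hc2 (h.mono fun t ht => congrFun ht i)
        (Ioo_subset_Icc_self ht)

theorem sobolevEval_sobolevDeriv {k l j : ℕ} (h : j + (l + 1) ≤ k) (x : sobolev hab p k) :
    sobolevEval hab p l (sobolevDeriv hab p j (l + 1) h x) = der j x a :=
  rep_eqOn (continuousOn_der x (by omega)) (rep_sobolevDeriv h x) (left_mem_Icc.2 hab.le)

/-- The Cauchy data `(y_i^{(j)}(a))_{j, i}`. -/
noncomputable def cauchyData (hab : a < b) (p : ℝ≥0∞) [Fact (1 ≤ p)] (m n r : ℕ) :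
    (Fin m → sobolev hab p (n + r)) →ₗ[ℂ] (Fin r → Fin m → ℂ) :=
  LinearMap.pi fun j => LinearMap.pi fun i =>
    (sobolevEval hab p n).toLinearMap ∘ₗ
      (sobolevDeriv hab p j (n + 1) (by omega)).toLinearMap ∘ₗ LinearMap.proj i

theorem cauchyData_apply (y : Fin m → sobolev hab p (n + r)) (j : Fin r) (i : Fin m) :
    cauchyData hab p m n r y j i = der j (y i) a :=
  sobolevEval_sobolevDeriv (j := j) (l := n) (by omega) (y i)

theorem exists_diffOp_eq_cauchyData_eq (hr : 0 < r)
    (A : Fin r → Matrix (Fin m) (Fin m) (sobolev hab p n)) (f : Fin m → sobolev hab p n)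
    (c : Fin r → Fin m → ℂ) : ∃ y, diffOp A y = f ∧ cauchyData hab p m n r y = c := by
  obtain ⟨q, rfl⟩ : ∃ q, r = q + 1 := ⟨r - 1, by omega⟩
  obtain ⟨u, hu, hu1, hu2⟩ := exists_cauchy_solution hab hp.out
    (fun l i k => isSobolev_rep (A l i k)) (fun i => isSobolev_rep (f i)) c
  have hrep : ∀ i, EqOn (rep (sobolevMk hab (hu i))) (u i) (Icc a b) := fun i =>
    rep_eqOn (k := n + q) (hu i).continuousOn (rep_sobolevMk _)
  have hder : ∀ i j, EqOn (der j (sobolevMk hab (hu i)))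
      (iteratedDerivWithin j (u i) (Icc a b)) (Icc a b) := fun i j t ht =>
    iteratedDerivWithin_congr (hrep i) ht
  refine ⟨fun i => sobolevMk hab (hu i), ?_, ?_⟩
  · rw [diffOp_eq_iff_ae]
    filter_upwards [eventually_all.2 hu2, ae_restrict_mem measurableSet_Icc] with t h1 ht
    funext i
    rw [diffExpr_apply, hder i _ ht, h1 i, der_zero]
    simp only [Pi.sub_apply, Finset.sum_apply, Pi.mul_apply]
    simp only [hder _ _ ht]
    exact sub_add_cancel _ _
  · funext j i
    rw [cauchyData_apply, hder i _ (left_mem_Icc.2 hab.le)]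
    exact hu1 j i

/-- The element of `W_p^k` given by `t ↦ t^l / l!`. -/
noncomputable def sobolevMonomial (hab : a < b) (p : ℝ≥0∞) [Fact (1 ≤ p)] (k l : ℕ) :
    sobolev hab p k := sobolevMk hab (isSobolev_monomialFun hab k l)

theorem der_sobolevMonomial {k l d : ℕ} (h : l + d ≤ k) :
    der (l + d) (sobolevMonomial hab p k l) =ᵐ[volume.restrict (Icc a b)]
      fun _ => if d = 0 then 1 else 0 :=
  (der_ae_eq (isSobolev_monomialFun hab k l) (rep_sobolevMk _) h).trans
    ((ae_restrict_iff' measurableSet_Icc).2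
      (Eventually.of_forall (iteratedDerivWithin_monomialFun hab l d)))

/-- The derivative of order `l` of `t^l / l!` is 1. With `sobolevDeriv_monomial_of_lt` this supplies
the unit diagonal and the triangularity required of the test functions. -/
theorem sobolevMul_sobolevDeriv_monomial (x : sobolev hab p n) (l : Fin r) :
    sobolevMul hab p n x (sobolevDeriv hab p l (n + 1) (by omega)
      (sobolevMonomial hab p (n + r) l)) = x := by
  refine sobolev_ext ?_
  filter_upwards [rep_sobolevMul x
    (sobolevDeriv hab p l (n + 1) (by omega) (sobolevMonomial hab p (n + r) l)),
    rep_sobolevDeriv (j := l) (l := n + 1) (by omega) (sobolevMonomial hab p (n + r) l),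
    der_sobolevMonomial (hab := hab) (p := p) (k := n + r) (l := l) (d := 0) (by omega)]
    with t g1 g2 g3
  rw [add_zero] at g3
  rw [g1, Pi.mul_apply, g2, g3]
  simp

theorem sobolevDeriv_monomial_of_lt {j l : Fin r} (hj : l < j) :
    sobolevDeriv hab p j (n + 1) (by omega) (sobolevMonomial hab p (n + r) l) = 0 := by
  refine sobolev_ext ?_
  filter_upwards [rep_sobolevDeriv (j := j) (l := n + 1) (by omega)
    (sobolevMonomial hab p (n + r) l), rep_zero (hab := hab) (p := p) (k := n + 1),
    der_sobolevMonomial (hab := hab) (p := p) (k := n + r) (l := l) (d := (j : ℕ) - l)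
      (by omega)] with t g1 g2 g3
  have hlj : (l : ℕ) < j := hj
  rw [Nat.add_sub_cancel' hlj.le, if_neg (by omega)] at g3
  rw [g1, g2, g3]
  rfl

theorem solutionContinuous_diffOp_iff (hr : 0 < r) {ε₀ : ℝ} (hε₀ : 0 < ε₀)
    {A : ℝ → Fin r → Fin m → Fin m → sobolev hab p n}
    {B : ℝ → (Fin m → sobolev hab p (n + r)) →L[ℂ] (Fin (r * m) → ℂ)} :
    SolutionContinuous ε₀ (fun ε => diffOp (A ε)) (fun ε => B ε) ↔
      (∀ y, diffOp (A 0) y = 0 ∧ B 0 y = 0 → y = 0) ∧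
        Tendsto A (𝓝[>] 0) (𝓝 (A 0)) ∧
        ∀ y, Tendsto (fun ε => B ε y) (𝓝[>] 0) (𝓝 (B 0 y)) := by
  obtain ⟨K, hK, hμ⟩ := exists_norm_sobolevMulAux_le hab p n
  exact solutionContinuous_vectorOp_iff hε₀ (μ := sobolevMul hab p n)
    (D := fun j : Fin r => (sobolevDeriv hab p j (n + 1) (by omega)).toLinearMap)
    (T := (sobolevDeriv hab p r n (by omega)).toLinearMap) hK hμ
    (fun j x => norm_sobolevDeriv_le _ x) (fun x => norm_sobolevDeriv_le _ x)
    (e := fun l => sobolevMonomial hab p (n + r) l)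
    sobolevMul_sobolevDeriv_monomial (fun _ _ h => sobolevDeriv_monomial_of_lt h)
    (η := cauchyData hab p m n r) (exists_diffOp_eq_cauchyData_eq hr)

end

end BVP

theorem theorem4 (m n r : ℕ) (hm : 0 < m) (hr : 0 < r) (a b : ℝ) (hab : a < b)
    (p : ℝ≥0∞) [Fact (1 ≤ p)] (ε₀ : ℝ) (hε₀ : 0 < ε₀)
    (A : ℝ → Fin r → Matrix (Fin m) (Fin m) (BVP.sobolev hab p n))
    (B : ℝ → (Fin m → BVP.sobolev hab p (n + r)) →L[ℂ] (Fin (r * m) → ℂ)) :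
    BVP.DependsContinuously ε₀ A B ↔
      (∀ y : Fin m → BVP.sobolev hab p (n + r), BVP.IsSolution (A 0) (B 0) 0 0 y → y = 0) ∧
      (∀ j : Fin r, Tendsto (fun ε => A ε j) (𝓝[>] 0) (𝓝 (A 0 j))) ∧
      (∀ y : Fin m → BVP.sobolev hab p (n + r),
        Tendsto (fun ε => B ε y) (𝓝[>] 0) (𝓝 (B 0 y))) := by
  have h := BVP.solutionContinuous_diffOp_iff hr hε₀ (A := A) (B := B)
  have hA : Tendsto A (𝓝[>] 0) (𝓝 (A 0)) ↔
      ∀ j : Fin r, Tendsto (fun ε => A ε j) (𝓝[>] 0) (𝓝 (A 0 j)) := tendsto_pi_nhds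
  simp only [BVP.DependsContinuously, BVP.isSolution_iff]
  exact h.trans (and_congr_right' (and_congr_left' hA))
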